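/- Let $d\in\mathbb N$, $T>0$ and $Q_T=\mathbb R^d\times(0,T)$. Let $f:\mathbb R\to\mathbb R^d$ and $A:\mathbb R\to\mathbb R$ be Lipschitz continuous, with $A$ non-decreasing and $A(0)=0$. Let $\mu$ be a (not necessarily symmetric) Lévy measure, i.e. a nonnegative Radon measure on $\mathbb R^d\setminus\{0\}$ with $\int_{|z|>0}|z|^2\wedge 1\,\mu(dz)<\infty$, and let $$g_\mu[\phi](x)=\int_{|z|>0}\phi(x+z)-\phi(x)-z\cdot\nabla\phi(x)\mathbf 1_{|z|<1}\,\mu(dz).$$ Consider the initial value problem $$\partial_tu+\nabla\cdot f(u)=g_\mu[A(u)]\ \text{ in } Q_T,\qquad u(\cdot,0)=u_0\ \text{ in }\mathbb R^d.\tag{P}$$ For $k\in\mathbb R$ write $\eta_k(u)=|u-k|$, $\eta_k'(u)=\operatorname{sgn}(u-k)$ (with $\operatorname{sgn}(0)=0$), $q_k(u)=\eta_k'(u)(f(u)-f(k))$, and for $r>0$ write $$g_{\mu,r}^*[\varphi](x)=\int_{0<|z|\le r}\varphi(x-z)-\varphi(x)+z\cdot\nabla\varphi(x)\mathbf 1_{|z|<1}\,\mu(dz),$$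 $$g_\mu^r[\varphi](x)=\int_{|z|>r}\varphi(x+z)-\varphi(x)\,\mu(dz),\qquad \gamma_\mu^r=\int_{r<|z|<1}z\,\mu(dz).$$ A function $u$ is an entropy solution of (P) with initial data $u_0$ if (i) $u\in L^\infty(Q_T)\cap C([0,T];L^1(\mathbb R^d))$; (ii) for all $k\in\mathbb R$, all $r>0$ and all nonnegative $\varphi\in C_c^\infty(Q_T)$, $$\iint_{Q_T}\eta_k(u)\,\partial_t\varphi+q_k(u)\cdot\nabla\varphi+\eta_{A(k)}(A(u))\,g_{\mu,r}^*[\varphi]+\eta_k'(u)\,g_\mu^r[A(u)]\,\varphi+\eta_{A(k)}(A(u))\,\gamma_\mu^r\cdot\nabla\varphi\;dx\,dt\ \ge 0;$$ (iii) $u(\cdot,0)=u_0$ a.e. in $\mathbb R^d$. **Theorem.** Let $u$ and $v$ be two entropy solutions of (P) with initial data $u_0$ and $v_0$, respectively. Then, for all $t\in(0,T)$, $$\|u(\cdot,t)-v(\cdot,t)\|_{L^1(\mathbb R^d)}\le\|u_0-v_0\|_{L^1(\mathbb R^d)}.$$ In particular, if $u_0=v_0$ a.e., then $u=v$ a.e.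 on $Q_T$. -/

import Mathlib

open Real Set Filter Topology MeasureTheory
open scoped ContDiff

noncomputable section

/-- The space `ℝ^d` with its Euclidean norm. -/
abbrev Space (d : ℕ) : Type := EuclideanSpace ℝ (Fin d)

/-- The space-time strip `Q_T = ℝ^d × (0,T)`; points are written `(t, x)`, time first. -/
def strip (d : ℕ) (T : ℝ) : Set (ℝ × Space d) := Ioo 0 T ×ˢ univ

/-- Kruzkov entropy `η_k(u) = |u - k|`. -/
def eta (k u : ℝ) : ℝ := |u - k|

/-- Its derivative `η'_k(u) = sgn(u - k)`, with `sgn 0 = 0`. -/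
def etaPrime (k u : ℝ) : ℝ := Real.sign (u - k)

/-- Entropy flux `q_k(u) = η'_k(u) (f(u) - f(k))`. -/
def entropyFlux {d : ℕ} (f : ℝ → Space d) (k u : ℝ) : Space d :=
  etaPrime k u • (f u - f k)

/-- `μ` is a Lévy measure on `{|z| > 0}`: `∫_{|z|>0} |z|² ∧ 1 μ(dz) < ∞`. Since `{|z| > 0}` is
exhausted by the sets `{|z| ≥ 1/n}`, this makes `μ` finite on compact subsets of `{|z| > 0}`,
hence Radon there. A mass at the origin plays no role below. -/
def IsLevyMeasure {d : ℕ} (μ : Measure (Space d)) : Prop :=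
  ∫⁻ z in {z : Space d | 0 < ‖z‖}, ENNReal.ofReal (min (‖z‖ ^ 2) 1) ∂μ < ⊤

/-- The adjoint `g*_{μ,r}` of the small-jump part of the Lévy operator:
`g*_{μ,r}[φ](x) = ∫_{0<|z|≤r} φ(x-z) - φ(x) + z·∇φ(x) 1_{|z|<1} μ(dz)`. -/
def levySmallAdjoint {d : ℕ} (μ : Measure (Space d)) (r : ℝ) (φ : Space d → ℝ) (x : Space d) : ℝ :=
  ∫ z in {z : Space d | 0 < ‖z‖ ∧ ‖z‖ ≤ r},
    (φ (x - z) - φ x + {z : Space d | ‖z‖ < 1}.indicator (fun z => inner ℝ z (gradient φ x)) z) ∂μ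

/-- The large-jump part `g^r_μ[φ](x) = ∫_{|z|>r} φ(x+z) - φ(x) μ(dz)`. -/
def levyLarge {d : ℕ} (μ : Measure (Space d)) (r : ℝ) (φ : Space d → ℝ) (x : Space d) : ℝ :=
  ∫ z in {z : Space d | r < ‖z‖}, (φ (x + z) - φ x) ∂μ

/-- The drift vector `γ^r_μ = ∫_{r<|z|<1} z μ(dz)`. -/
def levyDrift {d : ℕ} (μ : Measure (Space d)) (r : ℝ) : Space d :=
  ∫ z in {z : Space d | r < ‖z‖ ∧ ‖z‖ < 1}, z ∂μ

/-- `φ ∈ C_c^∞(Q_T)`, `φ ≥ 0`. -/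
structure IsNonnegTestFunction {d : ℕ} (T : ℝ) (φ : ℝ × Space d → ℝ) : Prop where
  smooth : ContDiff ℝ ∞ φ
  hasCompactSupport : HasCompactSupport φ
  tsupport_subset : tsupport φ ⊆ strip d T
  nonneg : ∀ p, 0 ≤ φ p

/-- `u ∈ L^∞(Q_T) ∩ C([0,T]; L^1(ℝ^d))`, where `u t` is the function `u(·,t)`. -/
structure IsInSolutionClass {d : ℕ} (T : ℝ) (u : ℝ → Space d → ℝ) : Prop where
  memLp_top : MemLp (Function.uncurry u) ⊤ (volume.restrict (strip d T))
  memLp_one : ∀ t ∈ Icc 0 T, MemLp (u t) 1 volume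
  continuous_L1 : ∀ t ∈ Icc 0 T,
    Tendsto (fun s => eLpNorm (u s - u t) 1 volume) (𝓝[Icc 0 T] t) (𝓝 0)

/-- The integrand of the entropy inequality at `(t, x)`, with constant `k`, cut-off radius `r` and
test function `φ`:
`η_k(u) ∂_tφ + q_k(u)·∇φ + η_{A(k)}(A(u)) g*_{μ,r}[φ] + η'_k(u) g^r_μ[A(u)] φ
+ η_{A(k)}(A(u)) γ^r_μ·∇φ`. -/
def entropyIntegrand {d : ℕ} (f : ℝ → Space d) (A : ℝ → ℝ) (μ : Measure (Space d))
    (u : ℝ → Space d → ℝ) (k r : ℝ) (φ : ℝ × Space d → ℝ) (t : ℝ) (x : Space d) : ℝ :=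
  eta k (u t x) * deriv (fun s => φ (s, x)) t
    + inner ℝ (entropyFlux f k (u t x)) (gradient (fun y => φ (t, y)) x)
    + eta (A k) (A (u t x)) * levySmallAdjoint μ r (fun y => φ (t, y)) x
    + etaPrime k (u t x) * levyLarge μ r (fun y => A (u t y)) x * φ (t, x)
    + eta (A k) (A (u t x)) * inner ℝ (levyDrift μ r) (gradient (fun y => φ (t, y)) x)

/-- `u` is an entropy solution of `∂_t u + ∇·f(u) = g_μ[A(u)]` in `Q_T`, `u(·,0) = u₀`. -/
structure IsEntropySolution {d : ℕ} (T : ℝ) (f : ℝ → Space d) (A : ℝ → ℝ)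
    (μ : Measure (Space d)) (u₀ : Space d → ℝ) (u : ℝ → Space d → ℝ) : Prop where
  mem_class : IsInSolutionClass T u
  entropy_inequality : ∀ (k r : ℝ), 0 < r → ∀ φ : ℝ × Space d → ℝ, IsNonnegTestFunction T φ →
    0 ≤ ∫ p in strip d T, entropyIntegrand f A μ u k r φ p.1 p.2
  initial : u 0 =ᵐ[volume] u₀

end

/-! The proof is Kruzkov's doubling of variables. The entropy inequality of `u` at `(t, x)` is used
with `k = v(s, y)`, that of `v` at `(s, y)` with `k = u(t, x)`, both with the weight `τ(t, s) χ(x -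
y)`, `χ` even; the two are integrated over all pairs of points and added. Since `∇χ` is odd, the
flux and drift terms cancel pointwise (`doubledIntegrand_add_swap`). No cut-off at infinity is
needed, because `u`, `v`, `A(u)`, `A(v)` are integrable on the strip and `χ` confines `x - y` to a
bounded set.

The nonlocal terms are split at radius `r`. For jumps longer than `r` the measure is finite, and the
weight is invariant when `x` and `y` move by the same `z`; as `sgn(u - v)` is also a sign for `A(u)
- A(v)`, the jump term is at most a translated integral of `|A(u) - A(v)|` minus the untranslated
one, which is zero (`integral_sign_mul_jump_sub_le`). Jumps of length at most `r` contribute at most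
a multiple of `∫ |z|² μ(dz)` over `0 < |z| ≤ r`, which vanishes as `r → 0`. What remains is `∬ |u -
v| (∂_t + ∂_s)τ χ ≥ 0` (`integral_diagDeriv_nonneg`); symmetry of `μ` plays no role.

Now let `τ` be `ρ(t - s)` times a smoothed indicator of `[a, b]`. Then `(∂_t + ∂_s)τ` is a bump near
`(a, a)` minus one near `(b, b)`. As the mollifiers concentrate, continuity in time with values in
`L¹` and continuity of translations turn the two integrals into the `L¹` distances at times `a` and
`b` (`exists_average_close`), so the distance does not increase. Letting `a → 0` brings in the
initial data. -/

/-! ### Spatial translations of the strip -/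

/-- Lebesgue measure on the strip `Q_T`. -/
noncomputable abbrev stripMeasure (d : ℕ) (T : ℝ) : Measure (ℝ × Space d) :=
  volume.restrict (strip d T)

theorem stripMeasure_eq_prod (d : ℕ) (T : ℝ) :
    stripMeasure d T = (volume.restrict (Ioo 0 T)).prod (volume : Measure (Space d)) := by
  rw [stripMeasure, strip, Measure.volume_eq_prod, ← Measure.prod_restrict, Measure.restrict_univ]

/-- Spatial translation of a space-time point. -/
def spaceShift {d : ℕ} (z : Space d) (p : ℝ × Space d) : ℝ × Space d := (p.1, p.2 + z)

theorem measurable_spaceShift {d : ℕ} :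
    Measurable fun x : Space d × (ℝ × Space d) => spaceShift x.1 x.2 := by
  unfold spaceShift; fun_prop

theorem measurePreserving_spaceShift {d : ℕ} (T : ℝ) (z : Space d) :
    MeasurePreserving (spaceShift z) (stripMeasure d T) (stripMeasure d T) := by
  rw [stripMeasure_eq_prod]
  exact (MeasurePreserving.id _).prod (measurePreserving_add_right volume z)

/-- The jump `z` is a variable here, so that `a(t, x + z)` can be integrated jointly in the jump and
the point. -/
theorem measurePreserving_skew_spaceShift {d : ℕ} (T : ℝ) (ν : Measure (Space d)) [SFinite ν] :
    MeasurePreserving (fun x : Space d × (ℝ × Space d) => (x.1, spaceShift x.1 x.2))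
      (ν.prod (stripMeasure d T)) (ν.prod (stripMeasure d T)) :=
  (MeasurePreserving.id ν).skew_product measurable_spaceShift
    (ae_of_all _ fun z => (measurePreserving_spaceShift T z).map_eq)

/-- Moving both points by the same `z` leaves `x - y` unchanged; this is the symmetry behind the
sign of the long-jump term. -/
theorem measurePreserving_skew_spaceShift_pair {d : ℕ} (T : ℝ) (ν : Measure (Space d)) [SFinite ν] :
    MeasurePreserving (fun x : Space d × ((ℝ × Space d) × (ℝ × Space d)) =>
        (x.1, (spaceShift x.1 x.2.1, spaceShift x.1 x.2.2)))
      (ν.prod ((stripMeasure d T).prod (stripMeasure d T)))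
      (ν.prod ((stripMeasure d T).prod (stripMeasure d T))) := by
  refine (MeasurePreserving.id ν).skew_product (g := fun z (x : (ℝ × Space d) × (ℝ × Space d)) =>
    (spaceShift z x.1, spaceShift z x.2)) ?_
    (ae_of_all _ fun z => ((measurePreserving_spaceShift T z).prod
      (measurePreserving_spaceShift T z)).map_eq)
  unfold spaceShift Function.uncurry; fun_prop

/-! ### Integrability of functions in the solution class -/

theorem integral_abs_sub_eq_toReal {α : Type*} {m : MeasurableSpace α} {μ : Measure α} {g h : α → ℝ}
    (hg : MemLp g 1 μ) (hh : MemLp h 1 μ) :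
    ∫ x, |g x - h x| ∂μ = (eLpNorm (g - h) 1 μ).toReal := by
  rw [eLpNorm_one_eq_lintegral_enorm, ← integral_norm_eq_lintegral_enorm (hg.1.sub hh.1)]
  rfl

theorem IsInSolutionClass.tendsto_integral_abs {d : ℕ} {T : ℝ} {u : ℝ → Space d → ℝ}
    (hu : IsInSolutionClass T u) {t : ℝ} (ht : t ∈ Icc 0 T) :
    Tendsto (fun s => ∫ x, |u s x - u t x|) (𝓝[Icc 0 T] t) (𝓝 0) := by
  have h := (ENNReal.tendsto_toReal ENNReal.zero_ne_top).comp (hu.continuous_L1 t ht)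
  refine h.congr' ?_
  filter_upwards [self_mem_nhdsWithin] with s hs
  exact (integral_abs_sub_eq_toReal (hu.memLp_one s hs) (hu.memLp_one t ht)).symm

theorem IsInSolutionClass.integrable_slice {d : ℕ} {T : ℝ} {u : ℝ → Space d → ℝ}
    (hu : IsInSolutionClass T u) {t : ℝ} (ht : t ∈ Icc 0 T) : Integrable (u t) :=
  memLp_one_iff_integrable.1 (hu.memLp_one t ht)

theorem integral_abs_le_add {α : Type*} {m : MeasurableSpace α} {μ : Measure α} {g h : α → ℝ}
    (hg : Integrable g μ) (hh : Integrable h μ) :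
    ∫ x, |g x| ∂μ ≤ ∫ x, |h x| ∂μ + ∫ x, |g x - h x| ∂μ := by
  refine le_of_le_of_eq ?_ (integral_add hh.abs (hg.sub hh).abs)
  refine integral_mono hg.abs (hh.abs.add (hg.sub hh).abs) fun x => ?_
  have := abs_add_le (h x) (g x - h x)
  simpa using this

theorem IsInSolutionClass.bddAbove_integral_abs {d : ℕ} {T : ℝ} {u : ℝ → Space d → ℝ}
    (hu : IsInSolutionClass T u) : ∃ C, ∀ t ∈ Icc 0 T, ∫ x, |u t x| ≤ C := by
  have hcont : ContinuousOn (fun t => ∫ x, |u t x|) (Icc 0 T) := by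
    intro t ht
    have h := hu.tendsto_integral_abs ht
    refine tendsto_iff_norm_sub_tendsto_zero.2 ?_
    refine squeeze_zero' (Eventually.of_forall fun _ => norm_nonneg _) ?_ h
    filter_upwards [self_mem_nhdsWithin] with s hs
    have h1 := integral_abs_le_add (hu.integrable_slice hs) (hu.integrable_slice ht)
    have h2 := integral_abs_le_add (hu.integrable_slice ht) (hu.integrable_slice hs)
    simp_rw [abs_sub_comm (u t _)] at h2
    rw [Real.norm_eq_abs, abs_le]
    constructor <;> linarith
  obtain ⟨C, hC⟩ := isCompact_Icc.bddAbove_image hcont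
  exact ⟨C, fun t ht => hC ⟨t, ht, rfl⟩⟩

/-- Joint measurability comes from the `L^∞(Q_T)` clause; the size comes from the `L¹` norms of the
slices, bounded by compactness of `[0, T]`, over a time interval of finite length. -/
theorem IsInSolutionClass.integrable {d : ℕ} {T : ℝ} {u : ℝ → Space d → ℝ}
    (hu : IsInSolutionClass T u) : Integrable (Function.uncurry u) (stripMeasure d T) := by
  have hm : AEStronglyMeasurable (Function.uncurry u) (stripMeasure d T) := hu.memLp_top.1
  rw [stripMeasure_eq_prod] at hm ⊢
  obtain ⟨C, hC⟩ := hu.bddAbove_integral_abs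
  refine (integrable_prod_iff hm).2 ⟨?_, ?_⟩
  · filter_upwards [ae_restrict_mem measurableSet_Ioo] with t ht
    exact hu.integrable_slice (Ioo_subset_Icc_self ht)
  · refine Integrable.of_bound hm.norm.integral_prod_right' C ?_
    filter_upwards [ae_restrict_mem measurableSet_Ioo] with t ht
    rw [Real.norm_of_nonneg (integral_nonneg fun _ => norm_nonneg _)]
    exact hC t (Ioo_subset_Icc_self ht)

/-! ### Integrability over pairs of points -/

/-- The product of an integrable function of the first point and a bounded kernel with support in
`{|x - y| ≤ R}` is integrable. -/
theorem integrable_mul_kernel_left {d : ℕ} {T R C : ℝ} {a : ℝ × Space d → ℝ}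
    (ha : Integrable a (stripMeasure d T)) {k : (ℝ × Space d) × (ℝ × Space d) → ℝ}
    (hk : AEStronglyMeasurable k ((stripMeasure d T).prod (stripMeasure d T)))
    (hC : ∀ p, |k p| ≤ C) (hR : ∀ p, R < ‖p.1.2 - p.2.2‖ → k p = 0) :
    Integrable (fun p => a p.1 * k p) ((stripMeasure d T).prod (stripMeasure d T)) := by
  have hC0 : 0 ≤ C := (abs_nonneg _).trans (hC 0)
  have hm : AEStronglyMeasurable (fun p : (ℝ × Space d) × (ℝ × Space d) => a p.1 * k p)
    ((stripMeasure d T).prod (stripMeasure d T)) := ha.1.comp_fst.mul hk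
  -- By translation invariance the cylinder over a ball of radius `R` has the same finite measure
  -- whatever the centre, so the inner integral is at most `|a p| * (C * M)`.
  set M : ℝ := (stripMeasure d T).real {q | ‖q.2‖ ≤ R} with hM
  have hball : ∀ x : Space d, stripMeasure d T {q | ‖x - q.2‖ ≤ R} =
      ENNReal.ofReal (T - 0) * volume (Metric.closedBall (0 : Space d) R) := by
    intro x
    have : {q : ℝ × Space d | ‖x - q.2‖ ≤ R} = univ ×ˢ Metric.closedBall x R := by
      ext q; simp [dist_eq_norm, norm_sub_rev]
    rw [this, stripMeasure_eq_prod, Measure.prod_prod, Measure.restrict_apply_univ, Real.volume_Ioo,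
      Measure.addHaar_closedBall_center]
  have hfin : ∀ x : Space d, stripMeasure d T {q | ‖x - q.2‖ ≤ R} < ⊤ := by
    intro x
    rw [hball]
    exact ENNReal.mul_lt_top ENNReal.ofReal_lt_top measure_closedBall_lt_top
  have hMx : ∀ x : Space d, (stripMeasure d T).real {q | ‖x - q.2‖ ≤ R} = M := by
    intro x
    have h0 := hball 0
    simp only [zero_sub, norm_neg] at h0
    rw [hM, measureReal_def, measureReal_def, h0, hball x]
  have hms : ∀ x : Space d, MeasurableSet {q : ℝ × Space d | ‖x - q.2‖ ≤ R} := fun x =>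
    measurableSet_le (by fun_prop) measurable_const
  have hdom : ∀ p q, ‖a p * k (p, q)‖ ≤
      {q : ℝ × Space d | ‖p.2 - q.2‖ ≤ R}.indicator (fun _ => |a p| * C) q := by
    intro p q
    by_cases h : ‖p.2 - q.2‖ ≤ R
    · rw [indicator_of_mem (by exact h), norm_mul]
      exact mul_le_mul_of_nonneg_left (hC _) (abs_nonneg _)
    · rw [indicator_of_notMem (by exact h), hR (p, q) (not_le.1 h)]
      simp
  have hint : ∀ p : ℝ × Space d, Integrable
      ({q : ℝ × Space d | ‖p.2 - q.2‖ ≤ R}.indicator (fun _ => |a p| * C)) (stripMeasure d T) :=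
    fun p => (integrable_indicator_iff (hms _)).2 (integrableOn_const (hfin _).ne)
  refine (integrable_prod_iff hm).2 ⟨?_, ?_⟩
  · filter_upwards [hm.prodMk_left] with p hp
    exact (hint p).mono' hp (ae_of_all _ (hdom p))
  · refine (ha.abs.mul_const (C * M)).mono' hm.norm.integral_prod_right' (ae_of_all _ fun p => ?_)
    rw [Real.norm_of_nonneg (integral_nonneg fun _ => norm_nonneg _)]
    refine (integral_mono_of_nonneg (ae_of_all _ fun _ => norm_nonneg _) (hint p)
      (ae_of_all _ (hdom p))).trans (le_of_eq ?_)
    rw [integral_indicator_const _ (hms _), hMx, smul_eq_mul]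
    ring

theorem integrable_mul_kernel_right {d : ℕ} {T R C : ℝ} {a : ℝ × Space d → ℝ}
    (ha : Integrable a (stripMeasure d T)) {k : (ℝ × Space d) × (ℝ × Space d) → ℝ}
    (hk : AEStronglyMeasurable k ((stripMeasure d T).prod (stripMeasure d T)))
    (hC : ∀ p, |k p| ≤ C) (hR : ∀ p, R < ‖p.1.2 - p.2.2‖ → k p = 0) :
    Integrable (fun p => a p.2 * k p) ((stripMeasure d T).prod (stripMeasure d T)) := by
  have := integrable_mul_kernel_left ha (k := fun p => k p.swap) hk.prod_swap
    (fun p => hC p.swap) (fun p hp => hR p.swap (by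
      rw [norm_sub_rev] at hp; exact hp))
  exact this.swap

/-- Integrability over pairs of points of a function dominated by a sum of integrable functions of
each point times a bounded kernel with support in `{|x - y| ≤ R}`. -/
theorem integrable_of_le_kernel {d : ℕ} {T R C : ℝ} {a b : ℝ × Space d → ℝ}
    (ha : Integrable a (stripMeasure d T)) (hb : Integrable b (stripMeasure d T))
    {k : (ℝ × Space d) × (ℝ × Space d) → ℝ} {E : (ℝ × Space d) × (ℝ × Space d) → ℝ}
    (hE : AEStronglyMeasurable E ((stripMeasure d T).prod (stripMeasure d T)))
    (hk : AEStronglyMeasurable k ((stripMeasure d T).prod (stripMeasure d T)))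
    (hC : ∀ p, |k p| ≤ C) (hR : ∀ p, R < ‖p.1.2 - p.2.2‖ → k p = 0)
    (hle : ∀ p, |E p| ≤ (|a p.1| + |b p.2|) * |k p|) :
    Integrable E ((stripMeasure d T).prod (stripMeasure d T)) := by
  have h1 := (integrable_mul_kernel_left ha hk hC hR).abs
  have h2 := (integrable_mul_kernel_right hb hk hC hR).abs
  refine (h1.add h2).mono' hE (ae_of_all _ fun p => ?_)
  refine (hle p).trans (le_of_eq ?_)
  simp only [Pi.add_apply, abs_mul]
  ring

/-! ### Long jumps: a finite jump measure -/

section Nonlocal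

variable {d : ℕ} {T : ℝ} {ν : Measure (Space d)} [IsFiniteMeasure ν]

theorem integrable_comp_spaceShift {a : ℝ × Space d → ℝ} (ha : Integrable a (stripMeasure d T)) :
    Integrable (fun x : Space d × (ℝ × Space d) => a (spaceShift x.1 x.2))
      (ν.prod (stripMeasure d T)) :=
  (measurePreserving_skew_spaceShift T ν).integrable_comp_of_integrable (ha.comp_snd ν)

/-- The jump operator `∫ (a(t, x + z) - a(t, x)) ν(dz)` of a finite measure, acting in space. -/
noncomputable def jump (ν : Measure (Space d)) (a : ℝ × Space d → ℝ) (p : ℝ × Space d) : ℝ :=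
  ∫ z, (a (spaceShift z p) - a p) ∂ν

theorem integrable_jump {a : ℝ × Space d → ℝ} (ha : Integrable a (stripMeasure d T)) :
    Integrable (jump ν a) (stripMeasure d T) :=
  ((integrable_comp_spaceShift (ν := ν) ha).sub (ha.comp_snd ν)).integral_prod_right

theorem ae_integrable_spaceShift {a : ℝ × Space d → ℝ} (ha : Integrable a (stripMeasure d T)) :
    ∀ᵐ p ∂(stripMeasure d T), Integrable (fun z => a (spaceShift z p)) ν :=
  (integrable_comp_spaceShift (ν := ν) ha).prod_left_ae

/-- The jump operators of `a` and `b`, tested with the sign of `a - b` and a kernel invariant under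
simultaneous translations, have a non-positive difference. -/
theorem integral_sign_mul_jump_sub_le {R C : ℝ} {a b : ℝ × Space d → ℝ}
    (ha : Integrable a (stripMeasure d T)) (hb : Integrable b (stripMeasure d T))
    {κ σ : (ℝ × Space d) × (ℝ × Space d) → ℝ}
    (hκ : AEStronglyMeasurable κ ((stripMeasure d T).prod (stripMeasure d T)))
    (hC : ∀ p, |κ p| ≤ C) (hR : ∀ p, R < ‖p.1.2 - p.2.2‖ → κ p = 0) (hκ0 : ∀ p, 0 ≤ κ p)
    (hinv : ∀ z p, κ (spaceShift z p.1, spaceShift z p.2) = κ p)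
    (hσ1 : ∀ p, |σ p| ≤ 1) (hσ : ∀ p, σ p * (a p.1 - b p.2) = |a p.1 - b p.2|) :
    ∫ p, κ p * (σ p * (jump ν a p.1 - jump ν b p.2))
      ∂((stripMeasure d T).prod (stripMeasure d T)) ≤ 0 := by
  set L := (stripMeasure d T).prod (stripMeasure d T) with hL
  set w : (ℝ × Space d) × (ℝ × Space d) → ℝ := fun p => κ p * |a p.1 - b p.2| with hw
  have hwm : AEStronglyMeasurable w L := hκ.mul (ha.1.comp_fst.sub hb.1.comp_snd).norm
  have hwi : Integrable w L := by
    refine integrable_of_le_kernel ha hb hwm hκ hC hR fun p => ?_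
    rw [hw, abs_mul, abs_abs, mul_comm]
    exact mul_le_mul_of_nonneg_right (abs_sub _ _) (abs_nonneg _)
  set H : Space d × ((ℝ × Space d) × (ℝ × Space d)) → ℝ :=
    fun x => w (spaceShift x.1 x.2.1, spaceShift x.1 x.2.2) with hH
  have hHi : Integrable H (ν.prod L) :=
    (measurePreserving_skew_spaceShift_pair T ν).integrable_comp_of_integrable (hwi.comp_snd ν)
  -- For each fixed `z` the simultaneous shift preserves the measure on pairs, so translating `w`
  -- does not change its integral.
  have hHint : ∫ p, ∫ z, H (z, p) ∂ν ∂L = ν.real univ * ∫ p, w p ∂L := by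
    have hz : ∀ z, ∫ p, H (z, p) ∂L = ∫ p, w p ∂L := by
      intro z
      have hmp := (measurePreserving_spaceShift (d := d) T z).prod (measurePreserving_spaceShift T z)
      rw [← hL] at hmp
      have hmw : AEStronglyMeasurable w (Measure.map (Prod.map (spaceShift z) (spaceShift z)) L) := by
        rw [hmp.map_eq]; exact hwm
      have := integral_map hmp.measurable.aemeasurable hmw
      rw [hmp.map_eq] at this
      exact this.symm
    rw [← integral_integral_swap (f := fun z p => H (z, p)) hHi]
    simp_rw [hz]
    rw [integral_const, smul_eq_mul]
  -- Without integrability the integral is `0` by convention and the claim is trivial.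
  by_cases hi : Integrable (fun p => κ p * (σ p * (jump ν a p.1 - jump ν b p.2))) L
  swap
  · rw [integral_undef hi]
  have hbound : ∀ᵐ p ∂L, κ p * (σ p * (jump ν a p.1 - jump ν b p.2)) ≤
      ∫ z, H (z, p) ∂ν - ν.real univ * w p := by
    filter_upwards [Measure.quasiMeasurePreserving_fst.ae (ae_integrable_spaceShift (ν := ν) ha),
      Measure.quasiMeasurePreserving_snd.ae (ae_integrable_spaceShift (ν := ν) hb)] with p hpa hpb
    have hda : Integrable (fun z => a (spaceShift z p.1) - a p.1) ν := hpa.sub (integrable_const _)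
    have hdb : Integrable (fun z => b (spaceShift z p.2) - b p.2) ν := hpb.sub (integrable_const _)
    have e1 : κ p * (σ p * (jump ν a p.1 - jump ν b p.2)) =
        ∫ z, κ p * (σ p * ((a (spaceShift z p.1) - a p.1) - (b (spaceShift z p.2) - b p.2))) ∂ν := by
      rw [integral_const_mul, integral_const_mul, integral_sub hda hdb]
      rfl
    have e2 : ∀ z, H (z, p) = κ p * |a (spaceShift z p.1) - b (spaceShift z p.2)| := fun z => by
      simp only [hH, hw]
      rw [hinv z p]
    have hd : Integrable (fun z => κ p * |a (spaceShift z p.1) - b (spaceShift z p.2)|) ν :=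
      ((hpa.sub hpb).abs).const_mul _
    have e3 : ∫ z, H (z, p) ∂ν - ν.real univ * w p =
        ∫ z, (κ p * |a (spaceShift z p.1) - b (spaceShift z p.2)| - w p) ∂ν := by
      rw [integral_sub hd (integrable_const _), integral_const, smul_eq_mul]
      simp_rw [e2]
    rw [e1, e3]
    refine integral_mono (((hda.sub hdb).const_mul _).const_mul _) (hd.sub (integrable_const _))
      fun z => ?_
    simp only [hw]
    rw [← mul_sub]
    refine mul_le_mul_of_nonneg_left ?_ (hκ0 p)
    -- Kato's inequality: `σ` turns the unshifted difference into its absolute value, and on the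
    -- shifted one it costs only `|σ| ≤ 1`.
    rw [← hσ p]
    have h1 : σ p * (a (spaceShift z p.1) - b (spaceShift z p.2)) ≤
        |a (spaceShift z p.1) - b (spaceShift z p.2)| := by
      refine (le_abs_self _).trans ?_
      rw [abs_mul]
      exact mul_le_of_le_one_left (abs_nonneg _) (hσ1 p)
    linarith
  refine (integral_mono_ae hi (hHi.integral_prod_right.sub (hwi.const_mul _)) hbound).trans ?_
  refine le_of_eq ((integral_sub hHi.integral_prod_right (hwi.const_mul _)).trans ?_)
  rw [hHint, integral_const_mul, sub_self]

end Nonlocal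

/-! ### Short jumps: Taylor bounds and the Lévy condition -/

theorem gradient_const_mul_comp_sub {E : Type*} [NormedAddCommGroup E] [InnerProductSpace ℝ E]
    [CompleteSpace E] {χ : E → ℝ} (hχ : Differentiable ℝ χ) (c : ℝ) (y x : E) :
    gradient (fun x => c * χ (x - y)) x = c • gradient χ (x - y) := by
  have h := ((hχ (x - y)).hasGradientAt.hasFDerivAt.comp x
    ((hasFDerivAt_id x).sub_const y)).const_mul c
  refine (hasGradientAt_iff_hasFDerivAt.2 (h.congr_fderiv ?_)).gradient
  ext v
  simp

theorem gradient_neg_of_even {E : Type*} [NormedAddCommGroup E] [InnerProductSpace ℝ E]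
    [CompleteSpace E] {χ : E → ℝ} (hχ : Differentiable ℝ χ) (heven : ∀ x, χ (-x) = χ x) (x : E) :
    gradient χ (-x) = -gradient χ x := by
  have h := (hχ (-x)).hasGradientAt.hasFDerivAt.comp x (hasFDerivAt_id x).neg
  have h2 : HasGradientAt χ (-gradient χ (-x)) x := by
    refine hasGradientAt_iff_hasFDerivAt.2 ((h.congr_fderiv ?_).congr_of_eventuallyEq ?_)
    · ext v; simp
    · exact Eventually.of_forall fun z => (heven z).symm
  rw [h2.gradient, neg_neg]

/-- The derivative is `C¹` with compact support, hence globally Lipschitz. The mean value inequality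
for `χ` minus its linear part, on the ball of radius `‖z‖` around `x`, then gives a constant uniform
in `x`. -/
theorem exists_second_order_bound {E : Type*} [NormedAddCommGroup E] [InnerProductSpace ℝ E]
    [CompleteSpace E] {χ : E → ℝ} (hχ : ContDiff ℝ ∞ χ) (hs : HasCompactSupport χ) :
    ∃ K : ℝ, ∀ x z, |χ (x - z) - χ x + inner ℝ z (gradient χ x)| ≤ K * ‖z‖ ^ 2 := by
  have hd : Differentiable ℝ χ := hχ.differentiable (by simp)
  obtain ⟨K, hK⟩ := (hχ.fderiv_right (m := 1) (by norm_cast)).lipschitzWith_of_hasCompactSupport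
    (hs.fderiv ℝ) one_ne_zero
  refine ⟨K, fun x z => ?_⟩
  have h := (convex_closedBall x ‖z‖).norm_image_sub_le_of_norm_fderiv_le'
    (𝕜 := ℝ) (f := χ) (φ := fderiv ℝ χ x) (C := K * ‖z‖) (x := x) (y := x - z)
    (fun w _ => hd w) (fun w hw => ?_) (by simp) (by simp)
  · have e : χ (x - z) - χ x - (fderiv ℝ χ x) (x - z - x) =
        χ (x - z) - χ x + inner ℝ z (gradient χ x) := by
      rw [inner_gradient_right]
      simp
    rw [e, Real.norm_eq_abs] at h
    refine h.trans (le_of_eq ?_)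
    rw [show x - z - x = -z by abel, norm_neg]
    ring
  · refine (hK.norm_sub_le w x).trans ?_
    rw [mem_closedBall_iff_norm] at hw
    gcongr

section Levy

variable {d : ℕ} {μ : Measure (Space d)}

theorem IsLevyMeasure.integrableOn (hμ : IsLevyMeasure μ) :
    IntegrableOn (fun z : Space d => min (‖z‖ ^ 2) 1) {z | 0 < ‖z‖} μ := by
  refine (lintegral_ofReal_ne_top_iff_integrable (by fun_prop)
    (ae_of_all _ fun z => by positivity)).1 (ne_of_lt hμ)

theorem measurableSet_punctured_closedBall (r : ℝ) :
    MeasurableSet {z : Space d | 0 < ‖z‖ ∧ ‖z‖ ≤ r} :=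
  (measurableSet_lt measurable_const measurable_norm).inter
    (measurableSet_le measurable_norm measurable_const)

theorem IsLevyMeasure.integrableOn_sq (hμ : IsLevyMeasure μ) {r : ℝ} (hr : r ≤ 1) :
    IntegrableOn (fun z : Space d => ‖z‖ ^ 2) {z | 0 < ‖z‖ ∧ ‖z‖ ≤ r} μ := by
  refine (hμ.integrableOn.mono_set fun z hz => hz.1).congr_fun ?_
    (measurableSet_punctured_closedBall r)
  intro z hz
  exact min_eq_left (pow_le_one₀ (norm_nonneg _) (hz.2.trans hr))

/-- Chebyshev's inequality for `|z|² ∧ 1`, which is at least `r² ∧ 1` on this set. -/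
theorem IsLevyMeasure.isFiniteMeasure_restrict (hμ : IsLevyMeasure μ) {r : ℝ} (hr : 0 < r) :
    IsFiniteMeasure (μ.restrict {z | r < ‖z‖}) := by
  refine ⟨?_⟩
  rw [Measure.restrict_apply_univ]
  have h := Integrable.measure_norm_ge_lt_top hμ.integrableOn (ε := min (r ^ 2) 1) (by positivity)
  refine (measure_mono ?_).trans_lt
    ((Measure.restrict_apply₀' (measurableSet_lt measurable_const
      measurable_norm).nullMeasurableSet).symm.trans_lt h)
  intro z hz
  have hz' : r < ‖z‖ := hz
  refine ⟨?_, hr.trans hz'⟩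
  rw [mem_ofPred_eq, Real.norm_of_nonneg (by positivity)]
  gcongr

/-- The second moment `∫_{0 < |z| ≤ r} |z|² μ(dz)` of the small jumps. -/
noncomputable def smallMoment (μ : Measure (Space d)) (r : ℝ) : ℝ :=
  ∫ z in {z : Space d | 0 < ‖z‖ ∧ ‖z‖ ≤ r}, ‖z‖ ^ 2 ∂μ

/-- The punctured balls decrease to the empty set, because the origin is excluded. The radii stay
below `1`, where `|z|²` is integrable. -/
theorem IsLevyMeasure.tendsto_smallMoment (hμ : IsLevyMeasure μ) :
    Tendsto (fun n : ℕ => smallMoment μ (1 / ((n : ℝ) + 2))) atTop (𝓝 0) := by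
  have h := tendsto_setIntegral_of_antitone (μ := μ) (f := fun z : Space d => ‖z‖ ^ 2)
    (s := fun n : ℕ => {z : Space d | 0 < ‖z‖ ∧ ‖z‖ ≤ 1 / ((n : ℝ) + 2)})
    (fun n => measurableSet_punctured_closedBall _) ?_ ⟨0, hμ.integrableOn_sq (by norm_num)⟩
  · have he : (⋂ n : ℕ, {z : Space d | 0 < ‖z‖ ∧ ‖z‖ ≤ 1 / ((n : ℝ) + 2)}) = ∅ := by
      refine eq_empty_of_forall_notMem fun z hz => ?_
      rw [mem_iInter] at hz
      obtain ⟨n, hn⟩ := exists_nat_one_div_lt (hz 0).1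
      have h1 := (hz n).2
      have h2 : 1 / ((n : ℝ) + 2) ≤ 1 / ((n : ℝ) + 1) := by gcongr; norm_num
      linarith
    rw [he, setIntegral_empty] at h
    exact h
  · intro m n hmn z hz
    refine ⟨hz.1, hz.2.trans ?_⟩
    gcongr

theorem levySmallAdjoint_const_mul_comp_sub {χ : Space d → ℝ} (hχ : Differentiable ℝ χ)
    (r c : ℝ) (y x : Space d) :
    levySmallAdjoint μ r (fun x => c * χ (x - y)) x = c * levySmallAdjoint μ r χ (x - y) := by
  unfold levySmallAdjoint
  rw [← integral_const_mul]
  congr 1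
  ext z
  rw [gradient_const_mul_comp_sub hχ, sub_right_comm]
  by_cases hz : ‖z‖ < 1
  · simp only [indicator_of_mem (show z ∈ {z : Space d | ‖z‖ < 1} from hz), inner_smul_right]
    ring
  · simp only [indicator_of_notMem (show z ∉ {z : Space d | ‖z‖ < 1} from hz)]
    ring

/-- Uniform bound, support and continuity of the small-jump operator on a test function. -/
theorem IsLevyMeasure.exists_levySmallAdjoint_bound (hμ : IsLevyMeasure μ) {χ : Space d → ℝ}
    (hχ : ContDiff ℝ ∞ χ) (hs : HasCompactSupport χ) :
    ∃ K R : ℝ, ∀ r, r < 1 → Continuous (levySmallAdjoint μ r χ) ∧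
      (∀ x, |levySmallAdjoint μ r χ x| ≤ K * smallMoment μ r) ∧
      ∀ x, R < ‖x‖ → levySmallAdjoint μ r χ x = 0 := by
  obtain ⟨K, hK⟩ := exists_second_order_bound hχ hs
  obtain ⟨R, hR⟩ := hs.isCompact.isBounded.exists_norm_le
  have hzero : ∀ x, R < ‖x‖ → χ x = 0 := fun x hx => by
    by_contra h
    exact absurd (hR x (subset_tsupport _ h)) (not_le.2 hx)
  have hgzero : ∀ x, R < ‖x‖ → gradient χ x = 0 := fun x hx => by
    by_contra h
    refine absurd (hR x ?_) (not_le.2 hx)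
    refine tsupport_fderiv_subset ℝ (subset_tsupport _ fun h0 => h ?_)
    rw [gradient, h0, map_zero]
  have hgc : Continuous (gradient χ) :=
    (InnerProductSpace.toDual ℝ (Space d)).symm.continuous.comp (hχ.continuous_fderiv (by simp))
  -- Jumps are shorter than `1`, so they enlarge the support by at most `1`; neither constant
  -- depends on `r`.
  refine ⟨K, R + 1, fun r hr => ?_⟩
  have hint := hμ.integrableOn_sq hr.le
  have heq : levySmallAdjoint μ r χ = fun x => ∫ z in {z : Space d | 0 < ‖z‖ ∧ ‖z‖ ≤ r},
      (χ (x - z) - χ x + inner ℝ z (gradient χ x)) ∂μ := by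
    ext x
    refine setIntegral_congr_fun (measurableSet_punctured_closedBall r) fun z hz => ?_
    simp only [indicator_of_mem (show z ∈ {z : Space d | ‖z‖ < 1} from hz.2.trans_lt hr)]
  rw [heq]
  refine ⟨?_, fun x => ?_, fun x hx => ?_⟩
  · refine continuous_of_dominated (bound := fun z => K * ‖z‖ ^ 2) (fun x => ?_)
      (fun x => ae_of_all _ fun z => hK x z) (hint.const_mul K) (ae_of_all _ fun z => ?_)
    · have := hχ.continuous
      exact Continuous.aestronglyMeasurable (by fun_prop)
    · have := hχ.continuous
      fun_prop
  · rw [smallMoment, ← integral_const_mul, ← Real.norm_eq_abs]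
    exact norm_integral_le_of_norm_le (hint.const_mul K) (ae_of_all _ fun z => hK x z)
  · refine (setIntegral_congr_fun (measurableSet_punctured_closedBall r)
      (g := fun _ => (0 : ℝ)) fun z hz => ?_).trans (by simp)
    have h1 : ‖x‖ - ‖z‖ ≤ ‖x - z‖ := norm_sub_norm_le x z
    have h2 := hz.2
    simp only
    rw [hzero x (by linarith), hzero (x - z) (by linarith), hgzero x (by linarith)]
    simp

end Levy

/-! ### Signs, kernels and weights -/

theorem Real.measurable_sign : Measurable Real.sign := by
  unfold Real.sign
  exact Measurable.ite measurableSet_Iio measurable_const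
    (Measurable.ite measurableSet_Ioi measurable_const measurable_const)

theorem Real.abs_sign_le_one (x : ℝ) : |Real.sign x| ≤ 1 := by
  rcases Real.sign_apply_eq x with h | h | h <;> rw [h] <;> norm_num

/-- This is where monotonicity of `A` enters: the Kruzkov sign of `u - v` serves for `A(u) - A(v)`
as well, even where `A` is flat. -/
theorem Monotone.sign_sub_mul_sub {A : ℝ → ℝ} (hA : Monotone A) (x y : ℝ) :
    Real.sign (x - y) * (A x - A y) = |A x - A y| := by
  rcases lt_trichotomy x y with h | h | h
  · rw [Real.sign_of_neg (sub_neg.2 h), abs_of_nonpos (sub_nonpos.2 (hA h.le)), neg_one_mul]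
  · simp [h]
  · rw [Real.sign_of_pos (sub_pos.2 h), abs_of_nonneg (sub_nonneg.2 (hA h.le)), one_mul]

/-- A bounded continuous kernel on pairs of space-time points supported in `{|x - y| ≤ R}`. -/
structure IsKernel {d : ℕ} (k : (ℝ × Space d) × (ℝ × Space d) → ℝ) : Prop where
  continuous : Continuous k
  bounded : ∃ C, ∀ p, |k p| ≤ C
  support : ∃ R, ∀ p, R < ‖p.1.2 - p.2.2‖ → k p = 0

theorem HasCompactSupport.exists_forall_norm_lt_imp_eq_zero {E F : Type*}
    [SeminormedAddCommGroup E] [Zero F] {g : E → F} (hg : HasCompactSupport g) :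
    ∃ R, ∀ x, R < ‖x‖ → g x = 0 := by
  obtain ⟨R, hR⟩ := hg.isCompact.isBounded.exists_norm_le
  refine ⟨R, fun x hx => ?_⟩
  by_contra h
  exact absurd (hR x (subset_tsupport _ h)) (not_le.2 hx)

/-- The kernel `α(t, s) g(x - y)`. -/
def tensorKernel {d : ℕ} (α : ℝ × ℝ → ℝ) (g : Space d → ℝ)
    (p : (ℝ × Space d) × (ℝ × Space d)) : ℝ :=
  α (p.1.1, p.2.1) * g (p.1.2 - p.2.2)

section Kernel

variable {d : ℕ} {T : ℝ}

theorem isKernel_tensorKernel {α : ℝ × ℝ → ℝ} (hα : Continuous α) (hαs : HasCompactSupport α)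
    {g : Space d → ℝ} (hg : Continuous g) (hgs : HasCompactSupport g) :
    IsKernel (tensorKernel α g) := by
  obtain ⟨C, hC⟩ := hα.bounded_above_of_compact_support hαs
  obtain ⟨D, hD⟩ := hg.bounded_above_of_compact_support hgs
  obtain ⟨R, hR⟩ := hgs.exists_forall_norm_lt_imp_eq_zero
  refine ⟨by unfold tensorKernel; fun_prop, ⟨C * D, fun p => ?_⟩, ⟨R, fun p hp => ?_⟩⟩
  · rw [tensorKernel, abs_mul]
    exact mul_le_mul (hC _) (hD _) (abs_nonneg _) ((norm_nonneg _).trans (hC 0))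
  · rw [tensorKernel, hR _ hp, mul_zero]

theorem IsKernel.integrable_of_le {k E : (ℝ × Space d) × (ℝ × Space d) → ℝ} (hk : IsKernel k)
    {a b : ℝ × Space d → ℝ} (ha : Integrable a (stripMeasure d T))
    (hb : Integrable b (stripMeasure d T))
    (hE : AEStronglyMeasurable E ((stripMeasure d T).prod (stripMeasure d T)))
    (hle : ∀ p, |E p| ≤ (|a p.1| + |b p.2|) * |k p|) :
    Integrable E ((stripMeasure d T).prod (stripMeasure d T)) := by
  obtain ⟨C, hC⟩ := hk.bounded
  obtain ⟨R, hR⟩ := hk.support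
  exact integrable_of_le_kernel ha hb hE hk.continuous.aestronglyMeasurable hC hR hle

theorem IsKernel.integrable_abs_sub_mul {k : (ℝ × Space d) × (ℝ × Space d) → ℝ} (hk : IsKernel k)
    {a b : ℝ × Space d → ℝ} (ha : Integrable a (stripMeasure d T))
    (hb : Integrable b (stripMeasure d T)) :
    Integrable (fun p => |a p.1 - b p.2| * k p) ((stripMeasure d T).prod (stripMeasure d T)) := by
  refine hk.integrable_of_le ha hb ((ha.1.comp_fst.sub hb.1.comp_snd).norm.mul
    hk.continuous.aestronglyMeasurable) fun p => ?_
  rw [abs_mul, abs_abs]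
  exact mul_le_mul_of_nonneg_right (abs_sub _ _) (abs_nonneg _)

end Kernel

/-- Non-negative smooth weight on pairs of times, compactly supported in `(0, T)²`. -/
structure IsTimeWeight (T : ℝ) (τ : ℝ × ℝ → ℝ) : Prop where
  smooth : ContDiff ℝ ∞ τ
  hasCompactSupport : HasCompactSupport τ
  tsupport_subset : tsupport τ ⊆ Ioo 0 T ×ˢ Ioo 0 T
  nonneg : ∀ p, 0 ≤ τ p

/-- Even non-negative smooth compactly supported function. -/
structure IsEvenBump {d : ℕ} (χ : Space d → ℝ) : Prop where
  smooth : ContDiff ℝ ∞ χ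
  hasCompactSupport : HasCompactSupport χ
  nonneg : ∀ x, 0 ≤ χ x
  even : ∀ x, χ (-x) = χ x

/-- Partial derivative in the first time variable. -/
noncomputable def timeDeriv (τ : ℝ × ℝ → ℝ) (p : ℝ × ℝ) : ℝ :=
  deriv (fun t => τ (t, p.2)) p.1

section Weights

variable {d : ℕ} {T : ℝ} {τ : ℝ × ℝ → ℝ} {χ : Space d → ℝ}

theorem IsTimeWeight.swap (hτ : IsTimeWeight T τ) : IsTimeWeight T (fun p => τ p.swap) where
  smooth := hτ.smooth.comp (contDiff_snd.prodMk contDiff_fst)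
  hasCompactSupport := hτ.hasCompactSupport.comp_homeomorph (Homeomorph.prodComm ℝ ℝ)
  tsupport_subset := by
    have h := tsupport_comp_subset_preimage τ (f := Prod.swap) continuous_swap
    exact fun p hp => (hτ.tsupport_subset (h hp)).symm
  nonneg p := hτ.nonneg _

theorem IsTimeWeight.timeDeriv_eq (hτ : IsTimeWeight T τ) :
    timeDeriv τ = fun p => fderiv ℝ τ p (1, 0) := by
  ext p
  have h := ((hτ.smooth.differentiable (by simp)) p).hasFDerivAt.comp_hasDerivAt p.1
    ((hasDerivAt_id p.1).prodMk (hasDerivAt_const p.1 p.2))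
  exact h.deriv

theorem IsTimeWeight.continuous_timeDeriv (hτ : IsTimeWeight T τ) : Continuous (timeDeriv τ) := by
  rw [hτ.timeDeriv_eq]
  exact (hτ.smooth.continuous_fderiv (by simp)).clm_apply continuous_const

theorem IsTimeWeight.hasCompactSupport_timeDeriv (hτ : IsTimeWeight T τ) :
    HasCompactSupport (timeDeriv τ) := by
  rw [hτ.timeDeriv_eq]
  exact hτ.hasCompactSupport.fderiv_apply ℝ _

theorem IsEvenBump.continuous_gradient (hχ : IsEvenBump χ) : Continuous (gradient χ) :=
  (InnerProductSpace.toDual ℝ (Space d)).symm.continuous.comp (hχ.smooth.continuous_fderiv (by simp))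

theorem IsEvenBump.hasCompactSupport_gradient (hχ : IsEvenBump χ) :
    HasCompactSupport (gradient χ) :=
  (hχ.hasCompactSupport.fderiv ℝ).comp_left
    (g := (InnerProductSpace.toDual ℝ (Space d)).symm) (map_zero _)

/-- The doubled weight is not compactly supported in `(x, y)`, but the entropy inequality only sees
it with `(s, y)` frozen. -/
theorem isNonnegTestFunction_slice (hτ : IsTimeWeight T τ) (hχ : IsEvenBump χ) (s : ℝ)
    (y : Space d) : IsNonnegTestFunction T (fun p : ℝ × Space d => τ (p.1, s) * χ (p.2 - y)) where
  smooth := (hτ.smooth.comp (contDiff_fst.prodMk contDiff_const)).mul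
    (hχ.smooth.comp (contDiff_snd.sub contDiff_const))
  hasCompactSupport := by
    refine HasCompactSupport.intro ((hτ.hasCompactSupport.isCompact.image continuous_fst).prod
      (hχ.hasCompactSupport.isCompact.image (continuous_add_const y))) fun p hp => ?_
    by_contra h
    refine hp ⟨⟨_, subset_tsupport _ (left_ne_zero_of_mul h), rfl⟩,
      ⟨_, subset_tsupport _ (right_ne_zero_of_mul h), by simp⟩⟩
  tsupport_subset := by
    intro p hp
    have h1 := tsupport_mul_subset_left hp
    have h2 := tsupport_comp_subset_preimage τ (f := fun p : ℝ × Space d => (p.1, s))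
      (by fun_prop) h1
    exact ⟨(hτ.tsupport_subset h2).1, mem_univ _⟩
  nonneg p := mul_nonneg (hτ.nonneg _) (hχ.nonneg _)

end Weights

/-! ### The doubled entropy inequality -/

/-- The entropy integrand of `u` at the first point with constant `k = v` at the second point and
test function `τ(t, s) χ(x - y)`. -/
noncomputable def doubledIntegrand {d : ℕ} (f : ℝ → Space d) (A : ℝ → ℝ) (μ : Measure (Space d))
    (r : ℝ) (τ : ℝ × ℝ → ℝ) (χ : Space d → ℝ) (u v : ℝ → Space d → ℝ)
    (p : (ℝ × Space d) × (ℝ × Space d)) : ℝ :=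
  |u p.1.1 p.1.2 - v p.2.1 p.2.2| * tensorKernel (timeDeriv τ) χ p
    + τ (p.1.1, p.2.1) * (Real.sign (u p.1.1 p.1.2 - v p.2.1 p.2.2) *
      inner ℝ (f (u p.1.1 p.1.2) - f (v p.2.1 p.2.2)) (gradient χ (p.1.2 - p.2.2)))
    + |A (u p.1.1 p.1.2) - A (v p.2.1 p.2.2)| * tensorKernel τ (levySmallAdjoint μ r χ) p
    + |A (u p.1.1 p.1.2) - A (v p.2.1 p.2.2)| *
      tensorKernel τ (fun x => inner ℝ (levyDrift μ r) (gradient χ x)) p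
    + tensorKernel τ χ p * (Real.sign (u p.1.1 p.1.2 - v p.2.1 p.2.2) *
      jump (μ.restrict {z | r < ‖z‖}) (fun q => A (u q.1 q.2)) p.1)

section Doubled

variable {d : ℕ} {T : ℝ} {f : ℝ → Space d} {A : ℝ → ℝ} {μ : Measure (Space d)} {r : ℝ}
  {τ : ℝ × ℝ → ℝ} {χ : Space d → ℝ} {u v : ℝ → Space d → ℝ}

theorem entropyIntegrand_slice (hχ : IsEvenBump χ)
    (p q : ℝ × Space d) :
    entropyIntegrand f A μ u (v q.1 q.2) r (fun p => τ (p.1, q.1) * χ (p.2 - q.2)) p.1 p.2 =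
      doubledIntegrand f A μ r τ χ u v (p, q) := by
  have hχd : Differentiable ℝ χ := hχ.smooth.differentiable (by simp)
  have hd : deriv (fun s => τ (s, q.1) * χ (p.2 - q.2)) p.1 =
      timeDeriv τ (p.1, q.1) * χ (p.2 - q.2) := deriv_mul_const_field _
  have hj : levyLarge μ r (fun y => A (u p.1 y)) p.2 =
      jump (μ.restrict {z | r < ‖z‖}) (fun q => A (u q.1 q.2)) p := rfl
  unfold entropyIntegrand doubledIntegrand tensorKernel
  simp only [hd, gradient_const_mul_comp_sub hχd, levySmallAdjoint_const_mul_comp_sub hχd, eta,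
    etaPrime, entropyFlux, inner_smul_left, inner_smul_right, hj, conj_trivial]
  ring

theorem integrable_comp_lipschitz {g : ℝ → ℝ} (hg : ∃ L, LipschitzWith L g) (hg0 : g 0 = 0)
    {α : Type*} {m : MeasurableSpace α} {ν : Measure α} {a : α → ℝ} (ha : Integrable a ν) :
    Integrable (fun p => g (a p)) ν := by
  obtain ⟨L, hL⟩ := hg
  refine (ha.abs.const_mul L).mono' (hL.continuous.comp_aestronglyMeasurable ha.1)
    (ae_of_all _ fun p => ?_)
  have := hL.norm_sub_le (a p) 0
  simpa [hg0] using this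

/-- Each of the five terms is an integrable function of one point, or a sum of two such, times a
kernel supported near the diagonal. For the flux the kernel is `Lf * ‖∇χ‖`; only `f(u) - f(v)`
occurs, so `f 0` is irrelevant. -/
theorem integrable_doubledIntegrand (hf : ∃ L, LipschitzWith L f) (hA : ∃ L, LipschitzWith L A)
    (hA_zero : A 0 = 0) (hμ : IsLevyMeasure μ) (hu : Integrable (Function.uncurry u) (stripMeasure d T))
    (hv : Integrable (Function.uncurry v) (stripMeasure d T)) (hτ : IsTimeWeight T τ)
    (hχ : IsEvenBump χ) (hr : 0 < r) (hr1 : r < 1) :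
    Integrable (doubledIntegrand f A μ r τ χ u v)
      ((stripMeasure d T).prod (stripMeasure d T)) := by
  have hAu := integrable_comp_lipschitz hA hA_zero hu
  have hAv := integrable_comp_lipschitz hA hA_zero hv
  have := hμ.isFiniteMeasure_restrict hr
  obtain ⟨Lf, hLf⟩ := hf
  obtain ⟨K, R, hKR⟩ := hμ.exists_levySmallAdjoint_bound hχ.smooth hχ.hasCompactSupport
  obtain ⟨hGc, -, hGs⟩ := hKR r hr1
  have hGcs : HasCompactSupport (levySmallAdjoint μ r χ) :=
    HasCompactSupport.intro (isCompact_closedBall 0 R) fun x hx => hGs x (by simpa using hx)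
  have hτc := hτ.smooth.continuous
  have hgc := hχ.continuous_gradient
  have hsm : AEStronglyMeasurable (fun p : (ℝ × Space d) × (ℝ × Space d) =>
      Real.sign (u p.1.1 p.1.2 - v p.2.1 p.2.2))
      ((stripMeasure d T).prod (stripMeasure d T)) :=
    (Real.measurable_sign.comp_aemeasurable
      (hu.1.comp_fst.sub hv.1.comp_snd).aemeasurable).aestronglyMeasurable
  have hkχ := isKernel_tensorKernel hτc hτ.hasCompactSupport hχ.smooth.continuous
    hχ.hasCompactSupport
  refine ((((?_ : Integrable _ _).add ?_).add ?_).add ?_).add ?_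
  · exact (isKernel_tensorKernel hτ.continuous_timeDeriv hτ.hasCompactSupport_timeDeriv
      hχ.smooth.continuous hχ.hasCompactSupport).integrable_abs_sub_mul hu hv
  · have hk := isKernel_tensorKernel hτc hτ.hasCompactSupport
      (g := fun x => (Lf : ℝ) * ‖gradient χ x‖) (by fun_prop)
      (hχ.hasCompactSupport_gradient.norm.mul_left)
    refine hk.integrable_of_le hu hv ?_ fun p => ?_
    · refine AEStronglyMeasurable.mul (by fun_prop) (hsm.mul ?_)
      exact ((hLf.continuous.comp_aestronglyMeasurable hu.1.comp_fst).sub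
        (hLf.continuous.comp_aestronglyMeasurable hv.1.comp_snd)).inner
          (Continuous.aestronglyMeasurable (by fun_prop))
    · have h1 := Real.abs_sign_le_one (u p.1.1 p.1.2 - v p.2.1 p.2.2)
      have h2 := abs_real_inner_le_norm (f (u p.1.1 p.1.2) - f (v p.2.1 p.2.2))
        (gradient χ (p.1.2 - p.2.2))
      have h3 := hLf.norm_sub_le (u p.1.1 p.1.2) (v p.2.1 p.2.2)
      have h4 := abs_sub (u p.1.1 p.1.2) (v p.2.1 p.2.2)
      rw [Real.norm_eq_abs] at h3
      simp only [tensorKernel, abs_mul, abs_norm, NNReal.abs_eq, Function.uncurry]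
      calc |τ (p.1.1, p.2.1)| * (|Real.sign (u p.1.1 p.1.2 - v p.2.1 p.2.2)| *
            |inner ℝ (f (u p.1.1 p.1.2) - f (v p.2.1 p.2.2)) (gradient χ (p.1.2 - p.2.2))|)
          ≤ |τ (p.1.1, p.2.1)| * (1 * ((Lf * (|u p.1.1 p.1.2| + |v p.2.1 p.2.2|)) *
              ‖gradient χ (p.1.2 - p.2.2)‖)) := by
            gcongr
            refine h2.trans ?_
            gcongr
            exact h3.trans (by gcongr)
        _ = _ := by ring
  · exact (isKernel_tensorKernel hτc hτ.hasCompactSupport hGc hGcs).integrable_abs_sub_mul hAu hAv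
  · refine (isKernel_tensorKernel hτc hτ.hasCompactSupport (by fun_prop)
      (hχ.hasCompactSupport_gradient.comp_left
        (g := fun w => inner ℝ (levyDrift μ r) w) (inner_zero_right _))).integrable_abs_sub_mul
        hAu hAv
  · have hJ := integrable_jump (ν := μ.restrict {z | r < ‖z‖}) hAu
    refine hkχ.integrable_of_le hJ (integrable_zero _ _ _)
      (hkχ.continuous.aestronglyMeasurable.mul (hsm.mul hJ.1.comp_fst)) fun p => ?_
    rw [abs_mul, abs_mul, mul_comm]
    refine mul_le_mul_of_nonneg_right
      (le_trans ?_ (le_add_of_nonneg_right (abs_nonneg _))) (abs_nonneg _)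
    exact mul_le_of_le_one_left (abs_nonneg _) (Real.abs_sign_le_one _)

/-- By Fubini with the second point outermost, the inner integral is the entropy inequality with the
constant `k = v(s, y)`, hence nonnegative for every `(s, y)`. -/
theorem IsEntropySolution.integral_doubledIntegrand_nonneg {u₀ : Space d → ℝ}
    (hu : IsEntropySolution T f A μ u₀ u) (hχ : IsEvenBump χ) (hτ : IsTimeWeight T τ) (hr : 0 < r)
    (hi : Integrable (doubledIntegrand f A μ r τ χ u v)
      ((stripMeasure d T).prod (stripMeasure d T))) :
    0 ≤ ∫ p, doubledIntegrand f A μ r τ χ u v p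
      ∂((stripMeasure d T).prod (stripMeasure d T)) := by
  rw [integral_prod_symm _ hi]
  refine integral_nonneg fun q => ?_
  have h := hu.entropy_inequality (v q.1 q.2) r hr _ (isNonnegTestFunction_slice hτ hχ q.1 q.2)
  simp_rw [entropyIntegrand_slice hχ] at h
  exact h

end Doubled

/-! ### Kato's inequality -/

/-- The derivative `∂_t τ + ∂_s τ` along the diagonal direction. -/
noncomputable def diagDeriv (τ : ℝ × ℝ → ℝ) (p : ℝ × ℝ) : ℝ :=
  timeDeriv τ p + timeDeriv (fun q => τ q.swap) p.swap

section Kato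

variable {d : ℕ} {T : ℝ} {f : ℝ → Space d} {A : ℝ → ℝ} {μ : Measure (Space d)} {r : ℝ}
  {τ : ℝ × ℝ → ℝ} {χ : Space d → ℝ} {u v : ℝ → Space d → ℝ}

/-- Adding the two doubled integrands, the flux and drift terms cancel. -/
theorem doubledIntegrand_add_swap (hχ : IsEvenBump χ) (p : (ℝ × Space d) × (ℝ × Space d)) :
    doubledIntegrand f A μ r τ χ u v p +
      doubledIntegrand f A μ r (fun q => τ q.swap) χ v u p.swap =
    |u p.1.1 p.1.2 - v p.2.1 p.2.2| * tensorKernel (diagDeriv τ) χ p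
    + |A (u p.1.1 p.1.2) - A (v p.2.1 p.2.2)| *
      tensorKernel τ (fun x => levySmallAdjoint μ r χ x + levySmallAdjoint μ r χ (-x)) p
    + tensorKernel τ χ p * (Real.sign (u p.1.1 p.1.2 - v p.2.1 p.2.2) *
      (jump (μ.restrict {z | r < ‖z‖}) (fun q => A (u q.1 q.2)) p.1 -
        jump (μ.restrict {z | r < ‖z‖}) (fun q => A (v q.1 q.2)) p.2)) := by
  have hχd : Differentiable ℝ χ := hχ.smooth.differentiable (by simp)
  obtain ⟨⟨t, x⟩, ⟨s, y⟩⟩ := p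
  simp only [doubledIntegrand, tensorKernel, diagDeriv, Prod.swap]
  rw [abs_sub_comm (v s y), abs_sub_comm (A (v s y)), ← neg_sub x y, hχ.even,
    gradient_neg_of_even hχd hχ.even, inner_neg_right, inner_neg_right, ← neg_sub (u t x) (v s y),
    ← neg_sub (f (u t x)), inner_neg_left, Real.sign_neg]
  ring

/-- Kato's inequality for the doubled variables, with all spatial operators eliminated. -/
theorem IsEntropySolution.integral_diagDeriv_nonneg {u₀ v₀ : Space d → ℝ}
    (hf : ∃ L, LipschitzWith L f) (hA : ∃ L, LipschitzWith L A) (hA_mono : Monotone A)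
    (hA_zero : A 0 = 0) (hμ : IsLevyMeasure μ)
    (hu : IsEntropySolution T f A μ u₀ u) (hv : IsEntropySolution T f A μ v₀ v)
    (hτ : IsTimeWeight T τ) (hχ : IsEvenBump χ) :
    0 ≤ ∫ p : (ℝ × Space d) × (ℝ × Space d),
      |u p.1.1 p.1.2 - v p.2.1 p.2.2| * tensorKernel (diagDeriv τ) χ p
        ∂((stripMeasure d T).prod (stripMeasure d T)) := by
  set L := (stripMeasure d T).prod (stripMeasure d T) with hL
  have hui := hu.mem_class.integrable
  have hvi := hv.mem_class.integrable
  have hAu : Integrable (fun q : ℝ × Space d => A (u q.1 q.2)) (stripMeasure d T) :=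
    integrable_comp_lipschitz hA hA_zero hui
  have hAv : Integrable (fun q : ℝ × Space d => A (v q.1 q.2)) (stripMeasure d T) :=
    integrable_comp_lipschitz hA hA_zero hvi
  have hτc := hτ.smooth.continuous
  have hχc := hχ.smooth.continuous
  obtain ⟨K, R, hKR⟩ := hμ.exists_levySmallAdjoint_bound hχ.smooth hχ.hasCompactSupport
  -- A fixed bump equal to `1` on the ball outside which the short-jump terms vanish: it dominates
  -- them for every `r < 1` with an integral independent of `r`. The sign of `R` is unknown, hence
  -- `|R|`.
  let ψ : ContDiffBump (0 : Space d) := ⟨|R| + 1, |R| + 2, by positivity, by linarith⟩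
  have hkψ := isKernel_tensorKernel hτc hτ.hasCompactSupport ψ.continuous ψ.hasCompactSupport
  have hψi : Integrable (fun p : (ℝ × Space d) × (ℝ × Space d) =>
      |A (u p.1.1 p.1.2) - A (v p.2.1 p.2.2)| * tensorKernel τ ψ p) L :=
    hkψ.integrable_abs_sub_mul hAu hAv
  have hN : Integrable (fun p : (ℝ × Space d) × (ℝ × Space d) =>
      |u p.1.1 p.1.2 - v p.2.1 p.2.2| * tensorKernel (diagDeriv τ) χ p) L := by
    refine (isKernel_tensorKernel ?_ ?_ hχc hχ.hasCompactSupport).integrable_abs_sub_mul hui hvi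
    · exact hτ.continuous_timeDeriv.add (hτ.swap.continuous_timeDeriv.comp continuous_swap)
    · exact hτ.hasCompactSupport_timeDeriv.add
        (hτ.swap.hasCompactSupport_timeDeriv.comp_homeomorph (Homeomorph.prodComm ℝ ℝ))
  have key : ∀ r, 0 < r → r < 1 →
      0 ≤ (∫ p, |u p.1.1 p.1.2 - v p.2.1 p.2.2| * tensorKernel (diagDeriv τ) χ p ∂L) +
        2 * K * smallMoment μ r *
          ∫ p, |A (u p.1.1 p.1.2) - A (v p.2.1 p.2.2)| * tensorKernel τ ψ p ∂L := by
    intro r hr hr1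
    have := hμ.isFiniteMeasure_restrict hr
    obtain ⟨hGc, hGb, hGs⟩ := hKR r hr1
    have h1 := integrable_doubledIntegrand hf hA hA_zero hμ hui hvi hτ hχ hr hr1
    have h2 := integrable_doubledIntegrand hf hA hA_zero hμ hvi hui hτ.swap hχ hr hr1
    have h3 := hu.integral_doubledIntegrand_nonneg hχ hτ hr h1
    have h4 := hv.integral_doubledIntegrand_nonneg hχ hτ.swap hr h2
    rw [← integral_prod_swap] at h4
    have hsum := add_nonneg h3 h4
    replace hsum := hsum.trans_eq (integral_add h1 h2.swap).symm
    have hGcs : HasCompactSupport (fun x => levySmallAdjoint μ r χ x + levySmallAdjoint μ r χ (-x)) :=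
      HasCompactSupport.intro (isCompact_closedBall 0 R) fun x hx => by
        have hx' : R < ‖x‖ := by simpa using hx
        rw [hGs x hx', hGs (-x) (by rwa [norm_neg]), add_zero]
    have hS : Integrable (fun p : (ℝ × Space d) × (ℝ × Space d) =>
        |A (u p.1.1 p.1.2) - A (v p.2.1 p.2.2)| * tensorKernel τ
          (fun x => levySmallAdjoint μ r χ x + levySmallAdjoint μ r χ (-x)) p) L :=
      (isKernel_tensorKernel hτc hτ.hasCompactSupport (by fun_prop) hGcs).integrable_abs_sub_mul
        hAu hAv
    have hJ : Integrable (fun p : (ℝ × Space d) × (ℝ × Space d) =>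
        tensorKernel τ χ p * (Real.sign (u p.1.1 p.1.2 - v p.2.1 p.2.2) *
        (jump (μ.restrict {z | r < ‖z‖}) (fun q => A (u q.1 q.2)) p.1 -
          jump (μ.restrict {z | r < ‖z‖}) (fun q => A (v q.1 q.2)) p.2))) L := by
      -- The long-jump term is the total minus the other two terms, all of them integrable.
      refine ((h1.add h2.swap).sub (hN.add hS)).congr (ae_of_all _ fun p => ?_)
      have := doubledIntegrand_add_swap (f := f) (A := A) (μ := μ) (r := r) (τ := τ) (u := u)
        (v := v) hχ p
      simp only [Pi.add_apply, Pi.sub_apply, Function.comp_apply]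
      rw [this]
      ring
    have hsplit := integral_add (hN.add hS) hJ
    simp only [Pi.add_apply] at hsplit
    rw [integral_add hN hS] at hsplit
    have hkχ := isKernel_tensorKernel hτc hτ.hasCompactSupport hχc hχ.hasCompactSupport
    obtain ⟨C, hC⟩ := hkχ.bounded
    obtain ⟨R', hR'⟩ := hkχ.support
    have hJle := integral_sign_mul_jump_sub_le (ν := μ.restrict {z | r < ‖z‖}) hAu hAv
      (σ := fun p => Real.sign (u p.1.1 p.1.2 - v p.2.1 p.2.2))
      hkχ.continuous.aestronglyMeasurable hC hR'
      (fun p => mul_nonneg (hτ.nonneg _) (hχ.nonneg _))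
      (fun z p => by simp [tensorKernel, spaceShift])
      (fun p => Real.abs_sign_le_one _) (fun p => hA_mono.sign_sub_mul_sub _ _)
    rw [← hL] at hJle
    have hSle : ∫ p, |A (u p.1.1 p.1.2) - A (v p.2.1 p.2.2)| * tensorKernel τ
          (fun x => levySmallAdjoint μ r χ x + levySmallAdjoint μ r χ (-x)) p ∂L ≤
        2 * K * smallMoment μ r *
          ∫ p, |A (u p.1.1 p.1.2) - A (v p.2.1 p.2.2)| * tensorKernel τ ψ p ∂L := by
      rw [← integral_const_mul]
      refine integral_mono hS (hψi.const_mul _) fun p => ?_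
      simp only [tensorKernel]
      have hb : levySmallAdjoint μ r χ (p.1.2 - p.2.2) + levySmallAdjoint μ r χ (-(p.1.2 - p.2.2)) ≤
          2 * K * smallMoment μ r * ψ (p.1.2 - p.2.2) := by
        set x := p.1.2 - p.2.2
        have b1 := hGb x
        have b2 := hGb (-x)
        rcases le_or_gt ‖x‖ R with hx | hx
        · rw [ψ.one_of_mem_closedBall (by
            rw [mem_closedBall_zero_iff]
            exact hx.trans ((le_abs_self R).trans (by simp [ψ])))]
          have := le_abs_self (levySmallAdjoint μ r χ x)
          have := le_abs_self (levySmallAdjoint μ r χ (-x))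
          linarith
        · rw [hGs x hx, hGs (-x) (by rwa [norm_neg]), add_zero]
          -- No sign of `K` is known; the product is nonnegative because it bounds an absolute
          -- value.
          have : 0 ≤ K * smallMoment μ r := (abs_nonneg _).trans b1
          have := mul_nonneg this (ψ.nonneg (x := x))
          linarith
      calc _ ≤ |A (u p.1.1 p.1.2) - A (v p.2.1 p.2.2)| * (τ (p.1.1, p.2.1) *
            (2 * K * smallMoment μ r * ψ (p.1.2 - p.2.2))) := by
            have := hτ.nonneg (p.1.1, p.2.1)
            gcongr
        _ = _ := by ring
    have hval : ∫ p, (doubledIntegrand f A μ r τ χ u v p +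
        (doubledIntegrand f A μ r (fun q => τ q.swap) χ v u) p.swap) ∂L = _ :=
      integral_congr_ae (ae_of_all _ fun p => doubledIntegrand_add_swap hχ p)
    have hsum' := hsum.trans_eq (hval.trans hsplit)
    linarith
  have hlim : Tendsto (fun n : ℕ =>
      (∫ p, |u p.1.1 p.1.2 - v p.2.1 p.2.2| * tensorKernel (diagDeriv τ) χ p ∂L) +
        2 * K * smallMoment μ (1 / ((n : ℝ) + 2)) *
          ∫ p, |A (u p.1.1 p.1.2) - A (v p.2.1 p.2.2)| * tensorKernel τ ψ p ∂L) atTop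
      (𝓝 ((∫ p, |u p.1.1 p.1.2 - v p.2.1 p.2.2| * tensorKernel (diagDeriv τ) χ p ∂L) +
        2 * K * 0 *
          ∫ p, |A (u p.1.1 p.1.2) - A (v p.2.1 p.2.2)| * tensorKernel τ ψ p ∂L)) :=
    ((hμ.tendsto_smallMoment.const_mul _).mul_const _).const_add _
  rw [mul_zero, zero_mul, add_zero] at hlim
  refine ge_of_tendsto' hlim fun n => key _ (by positivity) ?_
  rw [div_lt_one (by positivity)]
  have : (0 : ℝ) ≤ n := n.cast_nonneg
  linarith

end Kato

/-! ### Mollifiers and time weights -/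

/-- Even smooth probability density supported in the closed ball of radius `ε`. -/
structure IsMollifier {E : Type*} [NormedAddCommGroup E] [NormedSpace ℝ E] [MeasureSpace E]
    (ε : ℝ) (ρ : E → ℝ) : Prop where
  smooth : ContDiff ℝ ∞ ρ
  nonneg : ∀ x, 0 ≤ ρ x
  even : ∀ x, ρ (-x) = ρ x
  eq_zero : ∀ x, ε < ‖x‖ → ρ x = 0
  integral_eq_one : ∫ x, ρ x = 1

theorem exists_isMollifier (E : Type*) [NormedAddCommGroup E] [NormedSpace ℝ E]
    [FiniteDimensional ℝ E] [HasContDiffBump E] [MeasureSpace E] [BorelSpace E]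
    [IsLocallyFiniteMeasure (volume : Measure E)] [(volume : Measure E).IsOpenPosMeasure]
    {ε : ℝ} (hε : 0 < ε) : ∃ ρ : E → ℝ, IsMollifier ε ρ := by
  let φ : ContDiffBump (0 : E) := ⟨ε / 2, ε, by positivity, by linarith⟩
  refine ⟨φ.normed volume, φ.contDiff_normed, φ.nonneg_normed, φ.normed_neg, fun x hx => ?_,
    φ.integral_normed⟩
  by_contra h
  have h' : x ∈ Function.support (φ.normed volume) := h
  rw [φ.support_normed_eq, mem_ball_zero_iff] at h'
  exact absurd h' (not_lt.2 hx.le)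

theorem IsMollifier.hasCompactSupport {E : Type*} [NormedAddCommGroup E] [NormedSpace ℝ E]
    [ProperSpace E] [MeasureSpace E] {ε : ℝ} {ρ : E → ℝ} (hρ : IsMollifier ε ρ) :
    HasCompactSupport ρ :=
  HasCompactSupport.intro (isCompact_closedBall 0 ε) fun x hx => hρ.eq_zero x (by simpa using hx)

theorem IsMollifier.integrable {E : Type*} [NormedAddCommGroup E] [NormedSpace ℝ E]
    [ProperSpace E] [MeasureSpace E] [BorelSpace E] [IsLocallyFiniteMeasure (volume : Measure E)]
    {ε : ℝ} {ρ : E → ℝ} (hρ : IsMollifier ε ρ) : Integrable ρ :=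
  hρ.smooth.continuous.integrable_of_hasCompactSupport hρ.hasCompactSupport

theorem IsMollifier.isEvenBump {d : ℕ} {ε : ℝ} {χ : Space d → ℝ} (hχ : IsMollifier ε χ) :
    IsEvenBump χ :=
  ⟨hχ.smooth, hχ.hasCompactSupport, hχ.nonneg, hχ.even⟩

/-- The weight `ρ(t - s) ∫_a^b ρ(t - c) dc`. -/
noncomputable def slidingWeight (ρ : ℝ → ℝ) (a b : ℝ) (p : ℝ × ℝ) : ℝ :=
  ρ (p.1 - p.2) * ∫ c in a..b, ρ (p.1 - c)

/-- The weight `ρ(t - s) ρ(t - c)` concentrated near `(c, c)`. -/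
def pointWeight (ρ : ℝ → ℝ) (c : ℝ) (p : ℝ × ℝ) : ℝ :=
  ρ (p.1 - p.2) * ρ (p.1 - c)

section Sliding

variable {ε a b T : ℝ} {ρ : ℝ → ℝ}

theorem IsMollifier.hasDerivAt_integral (hρ : IsMollifier ε ρ) (t : ℝ) :
    HasDerivAt (fun t => ∫ c in a..b, ρ (t - c)) (ρ (t - a) - ρ (t - b)) t := by
  have hc := hρ.smooth.continuous
  have he : (fun t => ∫ c in a..b, ρ (t - c)) =
      fun t => (∫ x in (0 : ℝ)..(t - a), ρ x) - ∫ x in (0 : ℝ)..(t - b), ρ x := by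
    ext t
    rw [intervalIntegral.integral_comp_sub_left, intervalIntegral.integral_interval_sub_left
      (hc.intervalIntegrable _ _) (hc.intervalIntegrable _ _)]
  rw [he]
  have h : ∀ c, HasDerivAt (fun t => ∫ x in (0 : ℝ)..(t - c), ρ x) (ρ (t - c)) t := fun c => by
    have h1 := (hc.integral_hasStrictDerivAt 0 (t - c)).hasDerivAt
    exact HasDerivAt.comp_sub_const t c h1
  exact (h a).sub (h b)

/-- The window puts `t` within `ε` of `[a, b]` and `ρ(t - s)` puts `s` within `ε` of `t`, whence the
margin `2ε` at both ends of `(0, T)`. -/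
theorem IsMollifier.isTimeWeight_slidingWeight (hρ : IsMollifier ε ρ) (hab : a ≤ b)
    (ha : 2 * ε < a) (hb : b + 2 * ε < T) (hε : 0 < ε) :
    IsTimeWeight T (slidingWeight ρ a b) := by
  have hsub : tsupport (slidingWeight ρ a b) ⊆
      Icc (a - 2 * ε) (b + 2 * ε) ×ˢ Icc (a - 2 * ε) (b + 2 * ε) := by
    refine closure_minimal (fun p hp => ?_) (isClosed_Icc.prod isClosed_Icc)
    have h1 : |p.1 - p.2| ≤ ε := by
      by_contra h
      exact left_ne_zero_of_mul hp (hρ.eq_zero _ (not_le.1 h))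
    have h2 : a - ε ≤ p.1 ∧ p.1 ≤ b + ε := by
      by_contra h
      refine right_ne_zero_of_mul hp ?_
      refine (intervalIntegral.integral_congr (g := fun _ => (0 : ℝ)) fun c hc => ?_).trans (by simp)
      rw [uIcc_of_le hab] at hc
      refine hρ.eq_zero _ ?_
      rw [Real.norm_eq_abs, lt_abs]
      rw [not_and_or, not_le, not_le] at h
      rcases h with h | h
      · right; linarith [hc.1]
      · left; linarith [hc.2]
    rw [abs_le] at h1
    exact ⟨⟨by linarith, by linarith⟩, ⟨by linarith, by linarith⟩⟩
  refine ⟨?_, (isCompact_Icc.prod isCompact_Icc).of_isClosed_subset (isClosed_tsupport _) hsub,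
    hsub.trans (prod_mono ?_ ?_), fun p => mul_nonneg (hρ.nonneg _)
      (intervalIntegral.integral_nonneg hab fun c _ => hρ.nonneg _)⟩
  · have hθ : ContDiff ℝ ∞ (fun t => ∫ c in a..b, ρ (t - c)) := by
      rw [contDiff_infty_iff_deriv]
      refine ⟨fun t => (hρ.hasDerivAt_integral t).differentiableAt, ?_⟩
      rw [funext fun t => (hρ.hasDerivAt_integral (a := a) (b := b) t).deriv]
      exact (hρ.smooth.comp (contDiff_id.sub contDiff_const)).sub
        (hρ.smooth.comp (contDiff_id.sub contDiff_const))
    exact (hρ.smooth.comp (contDiff_fst.sub contDiff_snd)).mul (hθ.comp contDiff_fst)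
  all_goals exact fun x hx => ⟨by linarith [hx.1], by linarith [hx.2]⟩

/-- The factor `ρ(t - s)` is constant along the diagonal direction, so only the window is
differentiated, and its derivative is `ρ(t - a) - ρ(t - b)`. -/
theorem IsMollifier.diagDeriv_slidingWeight (hρ : IsMollifier ε ρ) (p : ℝ × ℝ) :
    diagDeriv (slidingWeight ρ a b) p = pointWeight ρ a p - pointWeight ρ b p := by
  have hd : ∀ x, HasDerivAt ρ (deriv ρ x) x := fun x =>
    (hρ.smooth.differentiable (by simp) x).hasDerivAt
  have h1 : HasDerivAt (fun t => ρ (t - p.2) * ∫ c in a..b, ρ (t - c))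
      (deriv ρ (p.1 - p.2) * (∫ c in a..b, ρ (p.1 - c)) +
        ρ (p.1 - p.2) * (ρ (p.1 - a) - ρ (p.1 - b))) p.1 :=
    (HasDerivAt.comp_sub_const p.1 p.2 (hd (p.1 - p.2))).mul (hρ.hasDerivAt_integral p.1)
  have h2 : HasDerivAt (fun s => ρ (p.1 - s) * ∫ c in a..b, ρ (p.1 - c))
      (-deriv ρ (p.1 - p.2) * (∫ c in a..b, ρ (p.1 - c))) p.2 :=
    (HasDerivAt.comp_const_sub p.1 p.2 (hd (p.1 - p.2))).mul_const _
  have e1 : timeDeriv (slidingWeight ρ a b) p = _ := h1.deriv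
  have e2 : timeDeriv (fun q => slidingWeight ρ a b q.swap) p.swap = _ := h2.deriv
  rw [diagDeriv, e1, e2, pointWeight, pointWeight]
  ring

theorem IsMollifier.pointWeight_ne_zero (hρ : IsMollifier ε ρ) {c : ℝ} {p : ℝ × ℝ}
    (hp : pointWeight ρ c p ≠ 0) : |p.1 - c| ≤ ε ∧ |p.2 - c| ≤ 2 * ε := by
  have h1 : |p.1 - p.2| ≤ ε := by
    by_contra h
    exact left_ne_zero_of_mul hp (hρ.eq_zero _ (not_le.1 h))
  have h2 : |p.1 - c| ≤ ε := by
    by_contra h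
    exact right_ne_zero_of_mul hp (hρ.eq_zero _ (not_le.1 h))
  refine ⟨h2, ?_⟩
  rw [abs_le] at *
  constructor <;> linarith

theorem IsMollifier.continuous_pointWeight (hρ : IsMollifier ε ρ) (c : ℝ) :
    Continuous (pointWeight ρ c) := by
  have := hρ.smooth.continuous
  unfold pointWeight
  fun_prop

theorem IsMollifier.hasCompactSupport_pointWeight (hρ : IsMollifier ε ρ) (c : ℝ) :
    HasCompactSupport (pointWeight ρ c) := by
  refine HasCompactSupport.intro (K := Metric.closedBall c ε ×ˢ Metric.closedBall c (2 * ε))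
    ((isCompact_closedBall _ _).prod (isCompact_closedBall _ _)) fun p hp => ?_
  by_contra h
  exact hp (hρ.pointWeight_ne_zero h)

theorem IsMollifier.integral_pointWeight (hρ : IsMollifier ε ρ) {c : ℝ} (hc : 2 * ε < c)
    (hcT : c + 2 * ε < T) (hε : 0 < ε) :
    ∫ p, pointWeight ρ c p ∂((volume.restrict (Ioo 0 T)).prod (volume.restrict (Ioo 0 T))) = 1 := by
  rw [Measure.prod_restrict, setIntegral_eq_integral_of_forall_compl_eq_zero]
  · rw [integral_prod _ ((hρ.continuous_pointWeight c).integrable_of_hasCompactSupport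
      (hρ.hasCompactSupport_pointWeight c))]
    have : ∀ t, ∫ s, pointWeight ρ c (t, s) = ρ (t - c) := fun t => by
      simp only [pointWeight]
      rw [integral_mul_const, integral_sub_left_eq_self (fun x => ρ x), hρ.integral_eq_one, one_mul]
    simp_rw [this]
    rw [integral_sub_right_eq_self (fun x => ρ x), hρ.integral_eq_one]
  · intro p hp
    by_contra h
    obtain ⟨h1, h2⟩ := hρ.pointWeight_ne_zero h
    rw [abs_le] at h1 h2
    exact hp ⟨⟨by linarith, by linarith⟩, ⟨by linarith, by linarith⟩⟩

end Sliding

/-! ### Concentration on the diagonal -/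

/-- Translations act continuously on `L¹`. -/
theorem tendsto_integral_abs_translate_sub {d : ℕ} {g : Space d → ℝ} (hg : Integrable g) :
    Tendsto (fun h : Space d => ∫ x, |g (x - h) - g x|) (𝓝 0) (𝓝 0) := by
  have hm : MemLp g 1 volume := memLp_one_iff_integrable.2 hg
  let τ : Space d → C(Space d, Space d) := fun h => ⟨fun x => x - h, by fun_prop⟩
  have hτ : Continuous τ :=
    ContinuousMap.continuous_of_continuous_uncurry _ (by
      change Continuous fun p : Space d × Space d => p.2 - p.1
      fun_prop)
  have hmp : ∀ h, MeasurePreserving (τ h) (volume : Measure (Space d)) volume := fun h =>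
    measurePreserving_sub_right volume h
  have hlim := (Filter.Tendsto.compMeasurePreservingLp (l := 𝓝 (0 : Space d))
    (f := fun _ => hm.toLp g) tendsto_const_nhds (hτ.tendsto 0) hmp (hmp 0) ENNReal.one_ne_top)
  have h0 : Lp.compMeasurePreserving (τ 0) (hmp 0) (hm.toLp g) = hm.toLp g := by
    refine Lp.ext ((Lp.coeFn_compMeasurePreserving _ (hmp 0)).trans ?_)
    refine Eventually.of_forall fun x => ?_
    simp [τ]
  rw [h0, tendsto_iff_norm_sub_tendsto_zero] at hlim
  refine hlim.congr fun h => ?_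
  rw [L1.norm_eq_integral_norm]
  refine integral_congr_ae ?_
  have e1 := Lp.coeFn_compMeasurePreserving (hm.toLp g) (hmp h)
  have e2 := (hmp h).quasiMeasurePreserving.ae_eq_comp hm.coeFn_toLp
  filter_upwards [e1, e2, hm.coeFn_toLp, Lp.coeFn_sub (Lp.compMeasurePreserving (τ h) (hmp h)
    (hm.toLp g)) (hm.toLp g)] with x h1 h2 h3 h4
  rw [h4, Pi.sub_apply, h1, h2, h3]
  rfl

/-- The substitution `y = x - h` makes the weight independent of `x`, so that integrating in `x`
first yields an `L¹` distance between time slices. -/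
theorem measurePreserving_doubling {d : ℕ} (T : ℝ) :
    MeasurePreserving (fun w : ((ℝ × ℝ) × Space d) × Space d =>
        ((w.1.1.1, w.2), (w.1.1.2, w.2 - w.1.2)))
      ((((volume.restrict (Ioo 0 T)).prod (volume.restrict (Ioo 0 T))).prod volume).prod volume)
      ((stripMeasure d T).prod (stripMeasure d T)) := by
  rw [stripMeasure_eq_prod]
  set I : Measure ℝ := volume.restrict (Ioo 0 T)
  set X : Measure (Space d) := volume
  have m1 := measurePreserving_prodAssoc (I.prod I) X X
  have m2 : MeasurePreserving (fun q : Space d × Space d => (q.2, q.2 - q.1)) (X.prod X)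
      (X.prod X) := by
    have h : MeasurePreserving (fun q : Space d × Space d => (q.1, q.1 - q.2)) (X.prod X)
        (X.prod X) :=
      (MeasurePreserving.id X).skew_product (g := fun x h => x - h) (by
        unfold Function.uncurry; fun_prop)
        (ae_of_all _ fun x => (Measure.measurePreserving_sub_left X x).map_eq)
    exact h.comp Measure.measurePreserving_swap
  have m3 := (MeasurePreserving.id (I.prod I)).prod m2
  have m4 := measurePreserving_prodAssoc I I (X.prod X)
  have m5 := (MeasurePreserving.id I).prod
    (((measurePreserving_prodAssoc X I X).comp
      ((Measure.measurePreserving_swap (μ := I) (ν := X)).prod (MeasurePreserving.id X))).comp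
      (measurePreserving_prodAssoc I X X).symm)
  have m6 := (measurePreserving_prodAssoc I X (I.prod X)).symm
  exact m6.comp (m5.comp (m4.comp (m3.comp m1)))

section Average

variable {d : ℕ} {T : ℝ} {u v : ℝ → Space d → ℝ}

theorem abs_integral_abs_sub_sub_le {g h g' h' : Space d → ℝ} (hg : Integrable g)
    (hh : Integrable h) (hg' : Integrable g') (hh' : Integrable h') :
    |(∫ x, |g x - h x|) - (∫ x, |g' x - h' x|)| ≤ (∫ x, |g x - g' x|) + ∫ x, |h x - h' x| := by
  have i1 := (hg.sub hh).abs
  have i2 := (hg'.sub hh').abs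
  have i3 := (hg.sub hg').abs
  have i4 := (hh.sub hh').abs
  have e1 : (∫ x, |g x - h x|) - ∫ x, |g' x - h' x| = ∫ x, (|g x - h x| - |g' x - h' x|) :=
    (integral_sub i1 i2).symm
  have e2 : (∫ x, |g x - g' x|) + ∫ x, |h x - h' x| = ∫ x, (|g x - g' x| + |h x - h' x|) :=
    (integral_add i3 i4).symm
  rw [e1, e2, ← Real.norm_eq_abs]
  refine norm_integral_le_of_norm_le (i3.add i4) (ae_of_all _ fun x => ?_)
  refine (abs_abs_sub_abs_le_abs_sub _ _).trans ?_
  rw [show g x - h x - (g' x - h' x) = (g x - g' x) - (h x - h' x) by ring]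
  exact abs_sub _ _

/-- Averages of `|u(t, x) - v(s, y)|` against mollifiers concentrating at time `c` and on the
diagonal `x = y` approximate the `L¹` distance at time `c`. -/
theorem IsInSolutionClass.exists_average_close (hu : IsInSolutionClass T u)
    (hv : IsInSolutionClass T v) {c : ℝ} (hc : c ∈ Ioo 0 T) {η : ℝ} (hη : 0 < η) :
    ∃ ε₀ > 0, ∀ ε, 0 < ε → ε < ε₀ → ∀ (ρ : ℝ → ℝ) (χ : Space d → ℝ), IsMollifier ε ρ →
      IsMollifier ε χ →
      |(∫ p, |u p.1.1 p.1.2 - v p.2.1 p.2.2| * tensorKernel (pointWeight ρ c) χ p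
        ∂((stripMeasure d T).prod (stripMeasure d T))) - (∫ x, |u c x - v c x|)| ≤ η := by
  have hc' : c ∈ Icc 0 T := Ioo_subset_Icc_self hc
  have hnhds : 𝓝[Icc 0 T] c = 𝓝 c := nhdsWithin_eq_nhds.2 (Icc_mem_nhds hc.1 hc.2)
  have h1 := hu.tendsto_integral_abs hc'
  have h2 := hv.tendsto_integral_abs hc'
  have h3 := tendsto_integral_abs_translate_sub (hv.integrable_slice hc')
  rw [hnhds] at h1 h2
  obtain ⟨δ₁, hδ₁, h1⟩ := Metric.eventually_nhds_iff.1 (h1.eventually_lt_const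
    (show (0 : ℝ) < η / 3 by positivity))
  obtain ⟨δ₂, hδ₂, h2⟩ := Metric.eventually_nhds_iff.1 (h2.eventually_lt_const
    (show (0 : ℝ) < η / 3 by positivity))
  obtain ⟨δ₃, hδ₃, h3⟩ := Metric.eventually_nhds_iff.1 (h3.eventually_lt_const
    (show (0 : ℝ) < η / 3 by positivity))
  have hc0 := hc.1
  have hcT := sub_pos.2 hc.2
  -- The halves are due to `s` being only within `2ε` of `c`; the last two entries keep both times
  -- inside `(0, T)`.
  refine ⟨min (min (δ₁ / 2) (δ₂ / 2)) (min δ₃ (min (c / 2) ((T - c) / 2))), by positivity, ?_⟩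
  intro ε hε hεlt ρ χ hρ hχ
  simp only [lt_min_iff] at hεlt
  obtain ⟨⟨l1, l2⟩, l3, l4, l5⟩ := hεlt
  set I : Measure ℝ := volume.restrict (Ioo 0 T) with hI
  set X : Measure (Space d) := volume with hX
  set D : ℝ := ∫ x, |u c x - v c x| with hD
  set F : (ℝ × Space d) × (ℝ × Space d) → ℝ := fun p =>
    |u p.1.1 p.1.2 - v p.2.1 p.2.2| * tensorKernel (pointWeight ρ c) χ p with hF
  have hFi : Integrable F ((stripMeasure d T).prod (stripMeasure d T)) :=
    (isKernel_tensorKernel (hρ.continuous_pointWeight c) (hρ.hasCompactSupport_pointWeight c)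
      hχ.smooth.continuous hχ.hasCompactSupport).integrable_abs_sub_mul
        hu.integrable hv.integrable
  have hmp := measurePreserving_doubling (d := d) T
  rw [← hI, ← hX] at hmp
  set φ : ((ℝ × ℝ) × Space d) × Space d → (ℝ × Space d) × (ℝ × Space d) := fun w =>
    ((w.1.1.1, w.2), (w.1.1.2, w.2 - w.1.2)) with hφ
  have hFφ : Integrable (F ∘ φ) (((I.prod I).prod X).prod X) :=
    hmp.integrable_comp_of_integrable hFi
  set W : (ℝ × ℝ) × Space d → ℝ := fun w => pointWeight ρ c w.1 * χ w.2 with hW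
  set Ψ : (ℝ × ℝ) × Space d → ℝ := fun w => ∫ x, |u w.1.1 x - v w.1.2 (x - w.2)| with hΨ
  have hslice : ∀ w, ∫ x, (F ∘ φ) (w, x) ∂X = W w * Ψ w := by
    intro w
    simp only [hF, hφ, hW, hΨ, Function.comp_apply, tensorKernel, sub_sub_cancel]
    rw [integral_mul_const, mul_comm]
  have hJ : ∫ p, F p ∂((stripMeasure d T).prod (stripMeasure d T)) =
      ∫ w, W w * Ψ w ∂((I.prod I).prod X) := by
    rw [← hmp.map_eq, integral_map hmp.measurable.aemeasurable (by rw [hmp.map_eq]; exact hFi.1)]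
    exact (integral_prod _ hFφ).trans (integral_congr_ae (ae_of_all _ hslice))
  have hWΨ : Integrable (fun w => W w * Ψ w) ((I.prod I).prod X) :=
    hFφ.integral_prod_left.congr (ae_of_all _ hslice)
  have hpi : Integrable (pointWeight ρ c) (I.prod I) := by
    rw [hI, Measure.prod_restrict]
    exact ((hρ.continuous_pointWeight c).integrable_of_hasCompactSupport
      (hρ.hasCompactSupport_pointWeight c)).integrableOn
  have hWi : Integrable W ((I.prod I).prod X) := hpi.mul_prod hχ.integrable
  have hW1 : ∫ w, W w ∂((I.prod I).prod X) = 1 := by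
    rw [integral_prod_mul, hρ.integral_pointWeight (by linarith) (by linarith) hε,
      hχ.integral_eq_one, one_mul]
  have hW0 : ∀ w, 0 ≤ W w := fun w =>
    mul_nonneg (mul_nonneg (hρ.nonneg _) (hρ.nonneg _)) (hχ.nonneg _)
  have hclose : ∀ w, W w ≠ 0 → |Ψ w - D| ≤ η := by
    intro w hw
    obtain ⟨b1, b2⟩ := hρ.pointWeight_ne_zero (left_ne_zero_of_mul hw)
    have b3 : ‖w.2‖ ≤ ε := by
      by_contra h
      exact right_ne_zero_of_mul hw (hχ.eq_zero _ (not_le.1 h))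
    have b1' := abs_le.1 b1
    have b2' := abs_le.1 b2
    have ht : w.1.1 ∈ Icc 0 T := ⟨by linarith, by linarith⟩
    have hs : w.1.2 ∈ Icc 0 T := ⟨by linarith, by linarith⟩
    have k1 : ∫ x, |u w.1.1 x - u c x| < η / 3 := h1 (by rw [Real.dist_eq]; linarith)
    have k2 : ∫ x, |v w.1.2 x - v c x| < η / 3 := h2 (by rw [Real.dist_eq]; linarith)
    have k3 : ∫ x, |v c (x - w.2) - v c x| < η / 3 := h3 (by rw [dist_zero_right]; linarith)
    have ivs := (hv.integrable_slice hs).comp_sub_right w.2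
    have ivc := (hv.integrable_slice hc').comp_sub_right w.2
    have m1 := abs_integral_abs_sub_sub_le (hu.integrable_slice ht) ivs (hu.integrable_slice hc')
      (hv.integrable_slice hc')
    -- Pass from `v(s, x - h)` to `v(c, x)` through `v(c, x - h)`: a change of time, then a
    -- translation. Together with the change of time in `u`, this makes three errors of `η / 3`.
    have m2 := integral_abs_le_add (ivs.sub (hv.integrable_slice hc'))
      (ivc.sub (hv.integrable_slice hc'))
    have m3 : ∫ x, |v w.1.2 (x - w.2) - v c (x - w.2)| = ∫ x, |v w.1.2 x - v c x| :=
      integral_sub_right_eq_self (fun x => |v w.1.2 x - v c x|) w.2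
    simp only [Pi.sub_apply, sub_sub_sub_cancel_right] at m2
    simp only [hΨ, hD]
    linarith
  have hdiff : (∫ w, W w * Ψ w ∂((I.prod I).prod X)) - D =
      ∫ w, W w * (Ψ w - D) ∂((I.prod I).prod X) := by
    have : ∫ w, W w * D ∂((I.prod I).prod X) = D := by rw [integral_mul_const, hW1, one_mul]
    simp_rw [mul_sub]
    rw [integral_sub hWΨ (hWi.mul_const D), this]
  rw [hJ, hdiff]
  have hfin := norm_integral_le_of_norm_le (hWi.mul_const η) (ae_of_all _ fun w => ?_)
    (f := fun w => W w * (Ψ w - D))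
  · rw [integral_mul_const, hW1, one_mul] at hfin
    exact hfin
  · rw [norm_mul, Real.norm_of_nonneg (hW0 w)]
    by_cases hw : W w = 0
    · rw [hw, zero_mul, zero_mul]
    · exact mul_le_mul_of_nonneg_left (hclose w hw) (hW0 w)

end Average

/-! ### The `L¹` contraction -/

section Contraction

variable {d : ℕ} {T : ℝ} {f : ℝ → Space d} {A : ℝ → ℝ} {μ : Measure (Space d)}
  {u v : ℝ → Space d → ℝ} {u₀ v₀ : Space d → ℝ}

theorem IsEntropySolution.integral_abs_sub_antitone (hf : ∃ L, LipschitzWith L f)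
    (hA : ∃ L, LipschitzWith L A) (hA_mono : Monotone A) (hA_zero : A 0 = 0)
    (hμ : IsLevyMeasure μ) (hu : IsEntropySolution T f A μ u₀ u)
    (hv : IsEntropySolution T f A μ v₀ v) {a b : ℝ} (ha : 0 < a) (hab : a ≤ b) (hb : b < T) :
    ∫ x, |u b x - v b x| ≤ ∫ x, |u a x - v a x| := by
  refine le_of_forall_pos_le_add fun η hη => ?_
  obtain ⟨ε₁, hε₁, h1⟩ := hu.mem_class.exists_average_close hv.mem_class (c := a)
    ⟨ha, hab.trans_lt hb⟩ (half_pos hη)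
  obtain ⟨ε₂, hε₂, h2⟩ := hu.mem_class.exists_average_close hv.mem_class (c := b)
    ⟨ha.trans_le hab, hb⟩ (half_pos hη)
  have hbT := sub_pos.2 hb
  -- One `ε` must serve both endpoints, since the same pair of mollifiers enters both averages; the
  -- last two bounds are the margins of the sliding weight.
  obtain ⟨ε, hε, hεlt⟩ := exists_between
    (show 0 < min (min ε₁ ε₂) (min (a / 2) ((T - b) / 2)) by positivity)
  simp only [lt_min_iff] at hεlt
  obtain ⟨⟨l1, l2⟩, l3, l4⟩ := hεlt
  obtain ⟨ρ, hρ⟩ := exists_isMollifier ℝ hε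
  obtain ⟨χ, hχ⟩ := exists_isMollifier (Space d) hε
  have hkato := hu.integral_diagDeriv_nonneg hf hA hA_mono hA_zero hμ hv
    (hρ.isTimeWeight_slidingWeight hab (by linarith) (by linarith) hε) hχ.isEvenBump
  have hi : ∀ c, Integrable (fun p : (ℝ × Space d) × (ℝ × Space d) =>
      |u p.1.1 p.1.2 - v p.2.1 p.2.2| * tensorKernel (pointWeight ρ c) χ p)
      ((stripMeasure d T).prod (stripMeasure d T)) := fun c =>
    (isKernel_tensorKernel (hρ.continuous_pointWeight c) (hρ.hasCompactSupport_pointWeight c)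
      hχ.smooth.continuous hχ.hasCompactSupport).integrable_abs_sub_mul
        hu.mem_class.integrable hv.mem_class.integrable
  have hsplit := integral_sub (hi a) (hi b)
  have heq : ∀ p : (ℝ × Space d) × (ℝ × Space d),
      |u p.1.1 p.1.2 - v p.2.1 p.2.2| * tensorKernel (diagDeriv (slidingWeight ρ a b)) χ p =
      |u p.1.1 p.1.2 - v p.2.1 p.2.2| * tensorKernel (pointWeight ρ a) χ p -
        |u p.1.1 p.1.2 - v p.2.1 p.2.2| * tensorKernel (pointWeight ρ b) χ p := fun p => by
    simp only [tensorKernel, hρ.diagDeriv_slidingWeight]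
    ring
  simp_rw [heq] at hkato
  rw [hsplit] at hkato
  have k1 := abs_le.1 (h1 ε hε l1 ρ χ hρ hχ)
  have k2 := abs_le.1 (h2 ε hε l2 ρ χ hρ hχ)
  linarith [k1.2, k2.1]

/-- Test functions vanish near `t = 0`, so the initial time is reached only in the limit of positive
times, by continuity in `L¹`. -/
theorem IsEntropySolution.integral_abs_sub_le_initial (hf : ∃ L, LipschitzWith L f)
    (hA : ∃ L, LipschitzWith L A) (hA_mono : Monotone A) (hA_zero : A 0 = 0)
    (hμ : IsLevyMeasure μ) (hu : IsEntropySolution T f A μ u₀ u)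
    (hv : IsEntropySolution T f A μ v₀ v) {t : ℝ} (ht : t ∈ Ioo 0 T) :
    ∫ x, |u t x - v t x| ≤ ∫ x, |u 0 x - v 0 x| := by
  have h0 : (0 : ℝ) ∈ Icc 0 T := ⟨le_rfl, (ht.1.trans ht.2).le⟩
  have hlim := ((hu.mem_class.tendsto_integral_abs h0).add
    (hv.mem_class.tendsto_integral_abs h0)).add_const (∫ x, |u 0 x - v 0 x|)
  rw [add_zero, zero_add] at hlim
  have hle : 𝓝[>] (0 : ℝ) ≤ 𝓝[Icc 0 T] 0 := by
    rw [← nhdsWithin_Ioo_eq_nhdsGT (ht.1.trans ht.2)]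
    exact nhdsWithin_mono _ Ioo_subset_Icc_self
  refine ge_of_tendsto (hlim.mono_left hle) ?_
  filter_upwards [Ioo_mem_nhdsGT ht.1] with s hs
  have hs' : s ∈ Icc 0 T := ⟨hs.1.le, (hs.2.trans ht.2).le⟩
  have m1 := hu.integral_abs_sub_antitone hf hA hA_mono hA_zero hμ hv hs.1 hs.2.le ht.2
  have m2 := abs_le.1 (abs_integral_abs_sub_sub_le (hu.mem_class.integrable_slice hs')
    (hv.mem_class.integrable_slice hs') (hu.mem_class.integrable_slice h0)
    (hv.mem_class.integrable_slice h0))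
  linarith [m2.2]

theorem IsEntropySolution.eLpNorm_sub_le (hf : ∃ L, LipschitzWith L f)
    (hA : ∃ L, LipschitzWith L A) (hA_mono : Monotone A) (hA_zero : A 0 = 0)
    (hμ : IsLevyMeasure μ) (hu : IsEntropySolution T f A μ u₀ u)
    (hv : IsEntropySolution T f A μ v₀ v) {t : ℝ} (ht : t ∈ Ioo 0 T) :
    eLpNorm (u t - v t) 1 volume ≤ eLpNorm (u₀ - v₀) 1 volume := by
  have h0 : (0 : ℝ) ∈ Icc 0 T := ⟨le_rfl, (ht.1.trans ht.2).le⟩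
  have ht' := Ioo_subset_Icc_self ht
  have hmt := (hu.mem_class.memLp_one t ht').sub (hv.mem_class.memLp_one t ht')
  have hm0 := (hu.mem_class.memLp_one 0 h0).sub (hv.mem_class.memLp_one 0 h0)
  rw [← eLpNorm_congr_ae (hu.initial.sub hv.initial),
    ← ENNReal.toReal_le_toReal hmt.eLpNorm_ne_top hm0.eLpNorm_ne_top,
    ← integral_abs_sub_eq_toReal (hu.mem_class.memLp_one t ht') (hv.mem_class.memLp_one t ht'),
    ← integral_abs_sub_eq_toReal (hu.mem_class.memLp_one 0 h0) (hv.mem_class.memLp_one 0 h0)]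
  exact hu.integral_abs_sub_le_initial hf hA hA_mono hA_zero hμ hv ht

end Contraction

theorem mainTheorem4 {d : ℕ} {T : ℝ} (hT : 0 < T)
    (f : ℝ → Space d) (hf : ∃ L, LipschitzWith L f)
    (A : ℝ → ℝ) (hA : ∃ L, LipschitzWith L A) (hA_mono : Monotone A) (hA_zero : A 0 = 0)
    (μ : Measure (Space d)) (hμ : IsLevyMeasure μ)
    (u₀ v₀ : Space d → ℝ) (u v : ℝ → Space d → ℝ)
    (hu : IsEntropySolution T f A μ u₀ u) (hv : IsEntropySolution T f A μ v₀ v) :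
    (∀ t ∈ Ioo 0 T, eLpNorm (u t - v t) 1 volume ≤ eLpNorm (u₀ - v₀) 1 volume) ∧
      (u₀ =ᵐ[volume] v₀ →
        ∀ᵐ p ∂(volume.restrict (strip d T)), u p.1 p.2 = v p.1 p.2) := by
  have hcontr : ∀ t ∈ Ioo 0 T, eLpNorm (u t - v t) 1 volume ≤ eLpNorm (u₀ - v₀) 1 volume :=
    fun t ht => hu.eLpNorm_sub_le hf hA hA_mono hA_zero hμ hv ht
  refine ⟨hcontr, fun h0 => ?_⟩
  have hslice : ∀ t ∈ Ioo 0 T, u t =ᵐ[volume] v t := fun t ht => by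
    have ht' := Ioo_subset_Icc_self ht
    have hz : eLpNorm (u₀ - v₀) 1 volume = 0 := by
      rw [eLpNorm_congr_ae (h0.sub (ae_eq_refl v₀)), sub_self, eLpNorm_zero]
    have h := le_antisymm ((hcontr t ht).trans_eq hz) zero_le
    rw [eLpNorm_eq_zero_iff ((hu.mem_class.memLp_one t ht').sub
      (hv.mem_class.memLp_one t ht')).1 one_ne_zero] at h
    exact h.mono fun x hx => sub_eq_zero.1 hx
  have hui := hu.mem_class.integrable
  have hvi := hv.mem_class.integrable
  -- Equality a.e. on each slice is transferred to the strip by Fubini, applied to the integrable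
  -- function `|u - v|`.
  have hint : ∫ p, |Function.uncurry u p - Function.uncurry v p| ∂(stripMeasure d T) = 0 := by
    have hi := (hui.sub hvi).abs
    rw [stripMeasure_eq_prod] at hi ⊢
    refine (integral_prod _ hi).trans ((integral_congr_ae (g := fun _ => (0 : ℝ)) ?_).trans
      (by simp))
    filter_upwards [ae_restrict_mem measurableSet_Ioo] with t ht
    refine (integral_congr_ae (g := fun _ => (0 : ℝ)) ?_).trans (by simp)
    filter_upwards [hslice t ht] with x hx
    simp [Function.uncurry, hx]
  replace hint := (integral_eq_zero_iff_of_nonneg (fun p => abs_nonneg _) (hui.sub hvi).abs).1 hint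
  filter_upwards [hint] with p hp
  exact sub_eq_zero.1 (abs_eq_zero.1 hp)
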